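/- **Theorem ($\mathfrak{gl}_n$ $q$-binomial theorem I).** Let $n\in\mathbb N$, let $q,t\in\mathbb C$ with $0<|q|<1$, $t\neq 0$, and $q^it^j\neq 1$ for all integers $i\geq 1$ and $1\leq j\leq n-1$. *Notation.* For $u\in\mathbb N^n$ put $|u|=u_1+\dots+u_n$. The spectral vector of $u$ is $\langle u\rangle=(q^{u_1}t^{k_1},\dots,q^{u_n}t^{k_n})$, where $(k_1,\dots,k_n)$ is the unique permutation of $(n-1,\dots,1,0)$ such that $k_i>k_j$ whenever $u_i>u_j$, or $u_i=u_j$ and $i<j$. For a box $s=(i,j)$ of the diagram of $u$ (that is, $1\le i\le n$, $1\le j\le u_i$) put $a(s)=u_i-j$ and $l(s)=|\{k>i: j\le u_k\le u_i\}|+|\{k<i: j\le u_k+1\le u_i\}|$, and let $n(u)=\sum_{s}l(s)$, $n'(u)=\sum_s a(s)$, $c'_u=\prod_{s}(1-q^{a(s)+1}t^{l(s)})$, where $s$ runs over the boxes of $u$. The interpolation Macdonald polynomial $M_u(x)\in\mathbb C[x_1,\dots,x_n]$ is the unique polynomial of degree $|u|$ such that $M_u(\langle v\rangle)=0$ for all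 $v\in\mathbb N^n$ with $|v|\le|u|$, $v\ne u$, and such that the coefficient of $x^u$ in $M_u$ is $q^{-n'(u)}$. Its normalisation is $\mathsf M_u(x)=q^{n'(u)}t^{n(u)}M_u(x)/c'_u$, and the generalised $q$-binomial coefficients are $\binom{u}{v}=\mathsf M_v(\langle u\rangle)/\mathsf M_v(\langle v\rangle)$. Write $(b)_\infty=\prod_{j\ge0}(1-bq^j)$. For alphabets (countable families of complex numbers) $\mathbb A,\mathbb B$ write $\sigma_a[\mathbb A-\mathbb B]=\prod_{y\in\mathbb B}(1-ay)\big/\prod_{z\in\mathbb A}(1-az)$, and let $\mathbb A/(1-q)$ be the alphabet of all letters $zq^j$ with $z\in\mathbb A$ and $j\ge 0$. *Claim.* These objects are well defined: for every $u\in\mathbb N^n$ the polynomial $M_u$ exists and is unique, $c'_u\neq0$ and $\mathsf M_u(\langle u\rangle)\ne0$. Moreover, for every $v\in\mathbb N^n$ and every $x\in\mathbb C^n$, with $\mathbb X=x_1+\dots+x_n$ and $\mathbb V=\langle v\rangle_1+\dots+\langle v\rangle_n$ (as alphabets), one has, as formal power series in $a$ over $\mathbb C$, $$\sum_{u\in\mathbb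 N^n} a^{|u|}\binom{u}{v}\mathsf M_u(x)=a^{|v|}\mathsf M_v(x)\prod_{i=1}^n\frac{(a\langle v\rangle_i)_\infty}{(ax_i)_\infty}=a^{|v|}\mathsf M_v(x)\,\sigma_a\!\left[\frac{\mathbb X-\mathbb V}{1-q}\right].$$ In particular (the case $v=0$), for every $x\in\mathbb C^n$, $$\sum_{u\in\mathbb N^n} a^{|u|}\mathsf M_u(x)=\prod_{i=1}^n\frac{(at^{n-i})_\infty}{(ax_i)_\infty}.$$ -/

import Mathlib

open scoped PowerSeries.WithPiTopology

noncomputable section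

namespace InterpolationMacdonald

variable {n : ℕ}

/-- The size `|u| = u₁ + ⋯ + uₙ` of a composition `u ∈ ℕⁿ`. -/
def size (u : Fin n → ℕ) : ℕ := ∑ i, u i

/-- The exponent `kᵢ` of `t` in the `i`-th entry of the spectral vector of `u`: the number of
positions ranked below `i` when positions are ranked by the value of `u`, equal values being ranked
in decreasing order from left to right.  So `kᵢ > kⱼ` if `uᵢ > uⱼ`, or if `uᵢ = uⱼ` and `i < j`. -/
def tExp (u : Fin n → ℕ) (i : Fin n) : ℕ :=
  (Finset.univ.filter fun j : Fin n => u j < u i ∨ (u j = u i ∧ i < j)).card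

/-- The spectral vector `⟨u⟩ = (q^{u₁} t^{k₁}, …, q^{uₙ} t^{kₙ})`. -/
def spec (q t : ℂ) (u : Fin n → ℕ) (i : Fin n) : ℂ := q ^ u i * t ^ tExp u i

/-- The leg-length `l(i,j)` of the box `(i,j)`, `1 ≤ j ≤ uᵢ`, of the diagram of `u`. -/
def leg (u : Fin n → ℕ) (i : Fin n) (j : ℕ) : ℕ :=
  (Finset.univ.filter fun k : Fin n => i < k ∧ j ≤ u k ∧ u k ≤ u i).card +
  (Finset.univ.filter fun k : Fin n => k < i ∧ j ≤ u k + 1 ∧ u k + 1 ≤ u i).card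

/-- The arm-length `a(i,j) = uᵢ - j` of the box `(i,j)`, `1 ≤ j ≤ uᵢ`, of the diagram of `u`. -/
def arm (u : Fin n → ℕ) (i : Fin n) (j : ℕ) : ℕ := u i - j

/-- `n(u)`, the sum of the leg-lengths of all boxes. -/
def legSum (u : Fin n → ℕ) : ℕ := ∑ i, ∑ j ∈ Finset.Icc 1 (u i), leg u i j

/-- `n'(u)`, the sum of the arm-lengths of all boxes. -/
def armSum (u : Fin n → ℕ) : ℕ := ∑ i, ∑ j ∈ Finset.Icc 1 (u i), arm u i j

/-- `c'_u = ∏ (1 - q^{a(s)+1} t^{l(s)})`, the product over all boxes `s` of the diagram of `u`. -/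
def cPrime (q t : ℂ) (u : Fin n → ℕ) : ℂ :=
  ∏ i, ∏ j ∈ Finset.Icc 1 (u i), (1 - q ^ (arm u i j + 1) * t ^ leg u i j)

/-- The defining property of the interpolation Macdonald polynomial `M_u(x) = M_u(x;q,t)`. -/
structure IsInterpolation (q t : ℂ) (u : Fin n → ℕ) (P : MvPolynomial (Fin n) ℂ) : Prop where
  /-- `P` has degree `|u|`. -/
  totalDegree_eq : P.totalDegree = size u
  /-- `P` vanishes at `⟨v⟩` for all compositions `v ≠ u` with `|v| ≤ |u|`. -/
  eval_eq_zero : ∀ v : Fin n → ℕ, size v ≤ size u → v ≠ u → MvPolynomial.eval (spec q t v) P = 0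
  /-- The coefficient of `x^u` in `P` is `q^{-n'(u)}`. -/
  coeff_eq : MvPolynomial.coeff (Finsupp.equivFunOnFinite.symm u) P = (q ^ armSum u)⁻¹

open Classical in
/-- The interpolation Macdonald polynomial `M_u(x)`: the polynomial with `IsInterpolation`
(its existence and uniqueness are not assumed anywhere; the value `0` is used if there is none). -/
def M (q t : ℂ) (u : Fin n → ℕ) : MvPolynomial (Fin n) ℂ :=
  if h : ∃ P, IsInterpolation q t u P then h.choose else 0

/-- The value at `x` of the normalised interpolation Macdonald polynomial
`𝖬_u(x) = q^{n'(u)} t^{n(u)} M_u(x) / c'_u`. -/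
def normM (q t : ℂ) (u : Fin n → ℕ) (x : Fin n → ℂ) : ℂ :=
  q ^ armSum u * t ^ legSum u * MvPolynomial.eval x (M q t u) / cPrime q t u

/-- The generalised `q`-binomial coefficient `[u, v] = 𝖬_v(⟨u⟩) / 𝖬_v(⟨v⟩)`. -/
def qbinom (q t : ℂ) (u v : Fin n → ℕ) : ℂ :=
  normM q t v (spec q t u) / normM q t v (spec q t v)

/-- `(ab;q)_∞ = ∏_{j ≥ 0} (1 - a b q^j)` as a formal power series in `a` (here `a` is
`PowerSeries.X`); the infinite product is taken coefficientwise. -/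
def qPochInf (q b : ℂ) : PowerSeries ℂ :=
  ∏' j : ℕ, (1 - PowerSeries.C (b * q ^ j) * PowerSeries.X)

/-- `σ_a[𝔸 - 𝔹] = ∏_{y ∈ 𝔹} (1 - a y) / ∏_{z ∈ 𝔸} (1 - a z)` as a formal power series in `a`,
for alphabets `𝔸`, `𝔹` given as families of letters. -/
def sigmaSub {ι κ : Type} (A : ι → ℂ) (B : κ → ℂ) : PowerSeries ℂ :=
  (∏' k, (1 - PowerSeries.C (B k) * PowerSeries.X)) *
    (∏' i, (1 - PowerSeries.C (A i) * PowerSeries.X))⁻¹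

/-- The alphabet `𝔸 / (1 - q)`, that is, the Cartesian product of `𝔸` with the alphabet
`1 + q + q² + ⋯`. -/
def divOneSub (q : ℂ) {ι : Type} (A : ι → ℂ) : ι × ℕ → ℂ := fun p => A p.1 * q ^ p.2

end InterpolationMacdonald

end

/-! Everything is read off from values at spectral vectors. Polynomials of degree at most `d` are
determined by their values at the `⟨w⟩` with `|w| ≤ d`, and these values can be prescribed freely
(`eq_zero_of_eval_spec_eq_zero`, `exists_eval_spec_eq`). The proof is a double induction: a
composition either ends in `0`, when the last spectral coordinate is `1` and `n` drops, or is
`φ(v)`, when that coordinate is not `1` and the size drops. On polynomials this is division by `xₙ -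
1`.

Hence there are dual polynomials `E_u`, equal to `1` at `⟨u⟩` and `0` at the other `⟨v⟩` with `|v| ≤
|u|`. The same recursion computes the coefficient of `x^u` in `E_u` (`IsDual.coeff_self`). It is
nonzero, so `M_u` exists and is unique, and its value gives `𝖬_u(⟨u⟩) = τ_u`, an explicit nonzero
product.

The coefficients of `a^m` on the two sides are polynomials in `x` of degree at most `m`, so it
suffices to compare them at `⟨w⟩` with `|w| ≤ m`. On the left only `u = w` survives, and only if
`|w| = m`. On the right `E_v(⟨w⟩)` appears. If it is nonzero, extra vanishing
(`IsDual.sub_of_eval_ne_zero`) says that `v` is contained in `w` compatibly with ranks. The infinite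
products then telescope to a polynomial in `a` of degree `|w| - |v|` with leading coefficient `τ_w /
τ_v`, which is exactly what the left side requires.

Extra vanishing holds because `E_u` is a joint eigenfunction of Cherednik-type operators `f ↦ xᵢ⁻¹(f
+ Kf)`, where `Kf` at `⟨w⟩` can be nonzero only if `f` is nonzero at some `⟨w'⟩` with `w'` contained
in `w` and one box smaller. Injectivity of `w ↦ ⟨w⟩` supplies an `i` whose eigenvalue separates `w`
from `u`, allowing descent from `w` to `u`. -/

noncomputable section

namespace InterpolationMacdonald

variable {n : ℕ}

/-! ### Compositions, their two generating moves, and ranks -/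

/-- The map `(u₁, …, uₙ) ↦ (u₂, …, uₙ, u₁ + 1)` on compositions. -/
def phi (u : Fin (n + 1) → ℕ) : Fin (n + 1) → ℕ :=
  Fin.snoc (α := fun _ => ℕ) (Fin.tail u) (u 0 + 1)

/-- Appending a zero to a composition. -/
def addZero (u : Fin n → ℕ) : Fin (n + 1) → ℕ := Fin.snoc (α := fun _ => ℕ) u 0

@[simp] lemma phi_last (u : Fin (n + 1) → ℕ) : phi u (Fin.last n) = u 0 + 1 := by simp [phi]

@[simp] lemma phi_castSucc (u : Fin (n + 1) → ℕ) (i : Fin n) : phi u i.castSucc = u i.succ := by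
  simp [phi, Fin.tail]

@[simp] lemma addZero_last (u : Fin n → ℕ) : addZero u (Fin.last n) = 0 := by simp [addZero]

@[simp] lemma addZero_castSucc (u : Fin n → ℕ) (i : Fin n) : addZero u i.castSucc = u i := by
  simp [addZero]

/-- The case split behind the double inductions: appending a zero lowers the number of variables,
`phi` lowers the size. -/
lemma eq_addZero_or_eq_phi (u : Fin (n + 1) → ℕ) :
    (∃ v, u = addZero v) ∨ ∃ v, u = phi v := by
  rcases Nat.eq_zero_or_pos (u (Fin.last n)) with h | h
  · refine Or.inl ⟨Fin.init u, funext fun i => ?_⟩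
    refine Fin.lastCases ?_ (fun i => ?_) i <;> simp [h, Fin.init]
  · refine Or.inr ⟨Fin.cons (α := fun _ => ℕ) (u (Fin.last n) - 1) (Fin.init u), funext fun i => ?_⟩
    refine Fin.lastCases ?_ (fun i => ?_) i
    · simp; omega
    · simp [Fin.init]

lemma addZero_injective : Function.Injective (addZero (n := n)) := by
  intro u v h
  funext i
  simpa using congrFun h i.castSucc

@[simp] lemma size_phi (u : Fin (n + 1) → ℕ) : size (phi u) = size u + 1 := by
  simp [size, Fin.sum_univ_castSucc (f := phi u), Fin.sum_univ_succ u]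
  ring

@[simp] lemma size_addZero (u : Fin n → ℕ) : size (addZero u) = size u := by
  simp [size, Fin.sum_univ_castSucc]

lemma eq_zero_of_size_eq_zero {u : Fin n → ℕ} (h : size u = 0) : u = 0 := by
  funext i
  exact (Finset.sum_eq_zero_iff.mp h) i (Finset.mem_univ i)

lemma not_last_lt_castSucc (i : Fin n) : ¬ Fin.last n < i.castSucc :=
  (Fin.castSucc_lt_last i).not_gt

lemma tExp_eq_sum (u : Fin n → ℕ) (i : Fin n) :
    tExp u i = ∑ j, if u j < u i ∨ (u j = u i ∧ i < j) then 1 else 0 := by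
  rw [tExp, Finset.card_filter]

@[simp] lemma tExp_phi_last (u : Fin (n + 1) → ℕ) : tExp (phi u) (Fin.last n) = tExp u 0 := by
  rw [tExp_eq_sum, tExp_eq_sum, Fin.sum_univ_castSucc, Fin.sum_univ_succ]
  simp [le_iff_lt_or_eq, not_last_lt_castSucc]

@[simp] lemma tExp_phi_castSucc (u : Fin (n + 1) → ℕ) (i : Fin n) :
    tExp (phi u) i.castSucc = tExp u i.succ := by
  rw [tExp_eq_sum, tExp_eq_sum, Fin.sum_univ_castSucc, Fin.sum_univ_succ, add_comm]
  simp [Fin.castSucc_lt_last, ← le_iff_lt_or_eq]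

@[simp] lemma tExp_addZero_last (u : Fin n → ℕ) : tExp (addZero u) (Fin.last n) = 0 := by
  rw [tExp_eq_sum, Fin.sum_univ_castSucc]
  simp [(Fin.castSucc_lt_last _).le]

@[simp] lemma tExp_addZero_castSucc (u : Fin n → ℕ) (i : Fin n) :
    tExp (addZero u) i.castSucc = tExp u i + 1 := by
  rw [tExp_eq_sum, tExp_eq_sum, Fin.sum_univ_castSucc]
  simp [Fin.castSucc_lt_last, Nat.pos_iff_ne_zero, eq_comm, em']

lemma tExp_lt (u : Fin n → ℕ) (i : Fin n) : tExp u i < n := by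
  have : (Finset.univ.filter fun j : Fin n => u j < u i ∨ (u j = u i ∧ i < j)) ⊂ Finset.univ := by
    refine Finset.filter_ssubset.mpr ⟨i, Finset.mem_univ i, by simp⟩
  simpa [tExp] using Finset.card_lt_card this

lemma tExp_lt_tExp {u : Fin n → ℕ} {i j : Fin n} (h : u i < u j) : tExp u i < tExp u j := by
  refine Finset.card_lt_card ?_
  rw [Finset.ssubset_iff_of_subset]
  · exact ⟨i, by simp [h], by simp⟩
  · intro k
    simp only [Finset.mem_filter, Finset.mem_univ, true_and]
    omega

/-- With equal neighbours, the left one outranks exactly the same positions as the right one, and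
the right one as well. -/
lemma tExp_of_eq {u : Fin (n + 1) → ℕ} {k : Fin n} (h : u k.castSucc = u k.succ) :
    tExp u k.castSucc = tExp u k.succ + 1 := by
  have : (Finset.univ.filter fun j => u j < u k.castSucc ∨ (u j = u k.castSucc ∧ k.castSucc < j)) =
      insert k.succ
        (Finset.univ.filter fun j => u j < u k.succ ∨ (u j = u k.succ ∧ k.succ < j)) := by
    ext j
    simp only [Finset.mem_filter, Finset.mem_univ, true_and, Finset.mem_insert, h, Fin.ext_iff,
      Fin.lt_def, Fin.val_succ, Fin.val_castSucc]
    constructor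
    · rintro (h | ⟨h, h'⟩)
      · omega
      · omega
    · rintro (h | h | h)
      · have : j = k.succ := Fin.ext (by simpa using h)
        subst this; right; simp
      · omega
      · omega
  rw [tExp, this, Finset.card_insert_of_notMem (by simp), tExp]

/-- Transposition of the positions `k` and `k + 1`. -/
abbrev adj (k : Fin n) : Equiv.Perm (Fin (n + 1)) := Equiv.swap k.castSucc k.succ

lemma adj_lt_adj (k : Fin n) {i j : Fin (n + 1)}
    (h : ¬ (i = k.castSucc ∧ j = k.succ)) (h' : ¬ (i = k.succ ∧ j = k.castSucc)) :
    adj k i < adj k j ↔ i < j := by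
  simp only [adj, Equiv.swap_apply_def]
  simp only [Fin.ext_iff, Fin.lt_def, Fin.val_succ, Fin.val_castSucc] at *
  split_ifs <;> simp <;> omega

/-- Left-to-right order matters only in ties, and the swap reverses the order of just one pair,
which is not tied. -/
lemma tExp_adj {u : Fin (n + 1) → ℕ} {k : Fin n} (h : u k.castSucc ≠ u k.succ) (i : Fin (n + 1)) :
    tExp (u ∘ adj k) i = tExp u (adj k i) := by
  refine Finset.card_bij (fun j _ => adj k j) ?_ (fun a _ b _ hab => (adj k).injective hab) ?_
  · intro j hj
    simp only [Finset.mem_filter, Finset.mem_univ, true_and, Function.comp] at hj ⊢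
    refine hj.imp_right fun ⟨h1, h2⟩ => ⟨h1, ?_⟩
    rwa [adj_lt_adj]
    · rintro ⟨rfl, rfl⟩; simp at h1; exact h h1
    · rintro ⟨rfl, rfl⟩; simp at h1; exact h h1.symm
  · intro j hj
    refine ⟨adj k j, ?_, by simp⟩
    simp only [Finset.mem_filter, Finset.mem_univ, true_and, Function.comp] at hj ⊢
    simp only [Equiv.swap_apply_self]
    refine hj.imp_right fun ⟨h1, h2⟩ => ⟨h1, ?_⟩
    rw [← adj_lt_adj k]
    · simpa using h2
    · rintro ⟨rfl, h3⟩
      have : j = k.castSucc := by rw [← Equiv.swap_apply_self k.castSucc k.succ j, h3]; simp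
      subst this; simp at h1; exact h h1
    · rintro ⟨rfl, h3⟩
      have : j = k.succ := by rw [← Equiv.swap_apply_self k.castSucc k.succ j, h3]; simp
      subst this; simp at h1; exact h h1.symm

lemma size_comp_perm (u : Fin n → ℕ) (σ : Equiv.Perm (Fin n)) : size (u ∘ σ) = size u :=
  Equiv.sum_comp σ u

/-! ### Leg statistics under the two moves -/

section Legs

lemma leg_eq_sum (u : Fin n → ℕ) (i : Fin n) (j : ℕ) :
    leg u i j = ∑ k, ((if i < k ∧ j ≤ u k ∧ u k ≤ u i then 1 else 0) +
      if k < i ∧ j ≤ u k + 1 ∧ u k + 1 ≤ u i then 1 else 0) := by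
  rw [leg, Finset.card_filter, Finset.card_filter, Finset.sum_add_distrib]

lemma leg_lt (u : Fin n → ℕ) (i : Fin n) (j : ℕ) : leg u i j < n := by
  rw [leg_eq_sum]
  have : ∑ k, ((if i < k ∧ j ≤ u k ∧ u k ≤ u i then 1 else 0) +
      if k < i ∧ j ≤ u k + 1 ∧ u k + 1 ≤ u i then 1 else 0) < ∑ _k : Fin n, 1 := by
    refine Finset.sum_lt_sum (fun k _ => ?_) ⟨i, Finset.mem_univ i, by simp⟩
    split_ifs <;> omega
  simpa using this

/-- The `+ 1` in the leg condition for rows to the left compensates for the first row becoming the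
last and gaining a box. So old boxes keep their legs, and the only new box is the first of the last
row. -/
lemma leg_phi_castSucc (u : Fin (n + 1) → ℕ) (i : Fin n) (j : ℕ) :
    leg (phi u) i.castSucc j = leg u i.succ j := by
  rw [leg_eq_sum, leg_eq_sum, Fin.sum_univ_castSucc, Fin.sum_univ_succ, add_comm]
  simp [Fin.castSucc_lt_last, (Fin.castSucc_lt_last _).le]

lemma leg_phi_last_succ (u : Fin (n + 1) → ℕ) (j : ℕ) :
    leg (phi u) (Fin.last n) (j + 1) = leg u 0 j := by
  rw [leg_eq_sum, leg_eq_sum, Fin.sum_univ_castSucc, Fin.sum_univ_succ, add_comm]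
  simp [Fin.castSucc_lt_last, not_last_lt_castSucc]

lemma leg_phi_last_one (u : Fin (n + 1) → ℕ) :
    leg (phi u) (Fin.last n) 1 = tExp u 0 := by
  rw [leg_eq_sum, tExp_eq_sum, Fin.sum_univ_castSucc, Fin.sum_univ_succ, add_comm]
  simp [Fin.castSucc_lt_last, not_last_lt_castSucc, ← le_iff_lt_or_eq]

lemma leg_addZero (u : Fin n → ℕ) (i : Fin n) {j : ℕ} (hj : 1 ≤ j) :
    leg (addZero u) i.castSucc j = leg u i j := by
  rw [leg_eq_sum, leg_eq_sum, Fin.sum_univ_castSucc]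
  simp [(Fin.castSucc_lt_last _).le]
  omega

lemma prod_Icc_one_succ {R : Type*} [CommMonoid R] (f : ℕ → R) (m : ℕ) :
    ∏ j ∈ Finset.Icc 1 (m + 1), f j = f 1 * ∏ j ∈ Finset.Icc 1 m, f (j + 1) := by
  simp only [← Finset.Ico_add_one_right_eq_Icc]
  rw [Finset.prod_eq_prod_Ico_succ_bot (by omega), ← Finset.prod_Ico_add' f 1 (m + 1) 1]

lemma sum_Icc_one_succ {R : Type*} [AddCommMonoid R] (f : ℕ → R) (m : ℕ) :
    ∑ j ∈ Finset.Icc 1 (m + 1), f j = f 1 + ∑ j ∈ Finset.Icc 1 m, f (j + 1) := by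
  simp only [← Finset.Ico_add_one_right_eq_Icc]
  rw [Finset.sum_eq_sum_Ico_succ_bot (by omega), ← Finset.sum_Ico_add' f 1 (m + 1) 1]

lemma legSum_phi (u : Fin (n + 1) → ℕ) : legSum (phi u) = legSum u + tExp u 0 := by
  rw [legSum, legSum, Fin.sum_univ_castSucc, Fin.sum_univ_succ]
  simp only [phi_castSucc, phi_last, leg_phi_castSucc, sum_Icc_one_succ, leg_phi_last_one]
  simp only [leg_phi_last_succ]
  ring

lemma legSum_addZero (u : Fin n → ℕ) : legSum (addZero u) = legSum u := by
  rw [legSum, legSum, Fin.sum_univ_castSucc]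
  simp only [addZero_castSucc, addZero_last]
  simp only [Finset.Icc_eq_empty (show ¬ (1 ≤ 0) by simp), Finset.sum_empty, add_zero]
  exact Finset.sum_congr rfl fun i _ => Finset.sum_congr rfl fun j hj =>
    leg_addZero u i (Finset.mem_Icc.mp hj).1

lemma cPrime_phi (q t : ℂ) (u : Fin (n + 1) → ℕ) :
    cPrime q t (phi u) = cPrime q t u * (1 - q ^ (u 0 + 1) * t ^ tExp u 0) := by
  rw [cPrime, cPrime, Fin.prod_univ_castSucc, Fin.prod_univ_succ]
  simp only [arm, phi_castSucc, phi_last, leg_phi_castSucc, prod_Icc_one_succ, leg_phi_last_one]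
  simp only [leg_phi_last_succ, Nat.add_sub_add_right, Nat.add_sub_cancel]
  ring

lemma cPrime_addZero (q t : ℂ) (u : Fin n → ℕ) : cPrime q t (addZero u) = cPrime q t u := by
  rw [cPrime, cPrime, Fin.prod_univ_castSucc]
  simp only [arm, addZero_castSucc, addZero_last]
  simp only [Finset.Icc_eq_empty (show ¬ (1 ≤ 0) by simp), Finset.prod_empty, mul_one]
  refine Finset.prod_congr rfl fun i _ => Finset.prod_congr rfl fun j hj => ?_
  rw [leg_addZero u i (Finset.mem_Icc.mp hj).1]

end Legs

/-! ### Generic parameters and spectral vectors -/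

/-- The parameters `q`, `t` are generic: `q` is nonzero of modulus less than one, `t ≠ 0`, and
`q ^ i * t ^ j ≠ 1` for `i ≥ 1` and `1 ≤ j < n`. -/
structure Generic (n : ℕ) (q t : ℂ) : Prop where
  q_ne_zero : q ≠ 0
  norm_lt_one : ‖q‖ < 1
  t_ne_zero : t ≠ 0
  pow_mul_pow_ne_one : ∀ i j : ℕ, 1 ≤ i → 1 ≤ j → j < n → q ^ i * t ^ j ≠ 1

variable {q t : ℂ}

lemma Generic.pred (h : Generic (n + 1) q t) : Generic n q t :=
  ⟨h.1, h.2, h.3, fun i j hi hj hn => h.4 i j hi hj (by omega)⟩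

lemma Generic.ne_one (h : Generic n q t) {i j : ℕ} (hi : 1 ≤ i) (hj : j < n) :
    q ^ i * t ^ j ≠ 1 := by
  rcases Nat.eq_zero_or_pos j with rfl | hj0
  · intro h1
    have h2 : ‖q‖ ^ i = 1 := by simpa using congrArg norm h1
    have h3 : ‖q‖ ^ i < 1 := pow_lt_one₀ (norm_nonneg q) h.2 (by omega)
    linarith
  · exact h.4 i j hi hj0 hj

lemma Generic.cPrime_ne_zero (h : Generic n q t) (u : Fin n → ℕ) : cPrime q t u ≠ 0 := by
  refine Finset.prod_ne_zero_iff.mpr fun i _ => Finset.prod_ne_zero_iff.mpr fun j _ => ?_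
  exact sub_ne_zero.mpr (h.ne_one (by omega) (leg_lt u i j)).symm

lemma Generic.spec_ne_zero (h : Generic n q t) (u : Fin n → ℕ) (i : Fin n) : spec q t u i ≠ 0 :=
  mul_ne_zero (pow_ne_zero _ h.1) (pow_ne_zero _ h.3)

/-- The larger entry also has the larger rank, so the ratio is `q^a t^b` with `a ≥ 1` and `0 < b <
n`. -/
lemma Generic.spec_ne_of_lt (h : Generic n q t) {u : Fin n → ℕ} {i j : Fin n} (hij : u i < u j) :
    spec q t u i ≠ spec q t u j := by
  have ht := tExp_lt_tExp hij
  have := h.ne_one (i := u j - u i) (j := tExp u j - tExp u i) (by omega)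
    (by have := tExp_lt u j; omega)
  intro he
  apply this
  have h1 : spec q t u j = spec q t u i * (q ^ (u j - u i) * t ^ (tExp u j - tExp u i)) := by
    rw [spec, spec, mul_mul_mul_comm, ← pow_add, ← pow_add]
    congr 2 <;> omega
  rw [← he] at h1
  exact (mul_eq_left₀ (h.spec_ne_zero u i)).mp h1.symm

lemma Generic.spec_ne_of_ne (h : Generic n q t) {u : Fin n → ℕ} {i j : Fin n} (hij : u i ≠ u j) :
    spec q t u i ≠ spec q t u j := by
  rcases lt_or_gt_of_ne hij with h1 | h1
  · exact h.spec_ne_of_lt h1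
  · exact (h.spec_ne_of_lt h1).symm

lemma spec_phi_last (u : Fin (n + 1) → ℕ) :
    spec q t (phi u) (Fin.last n) = q * spec q t u 0 := by
  simp [spec, pow_succ]; ring

lemma spec_phi_castSucc (u : Fin (n + 1) → ℕ) (i : Fin n) :
    spec q t (phi u) i.castSucc = spec q t u i.succ := by
  simp [spec]

lemma spec_addZero_last (u : Fin n → ℕ) : spec q t (addZero u) (Fin.last n) = 1 := by
  simp [spec]

lemma spec_addZero_castSucc (u : Fin n → ℕ) (i : Fin n) :
    spec q t (addZero u) i.castSucc = t * spec q t u i := by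
  simp [spec, pow_succ]; ring

lemma spec_adj {u : Fin (n + 1) → ℕ} {k : Fin n} (h : u k.castSucc ≠ u k.succ) :
    spec q t (u ∘ adj k) = spec q t u ∘ adj k := by
  funext i
  simp only [spec, tExp_adj h, Function.comp]

lemma spec_of_eq {u : Fin (n + 1) → ℕ} {k : Fin n} (h : u k.castSucc = u k.succ) :
    spec q t u k.castSucc = t * spec q t u k.succ := by
  simp only [spec, tExp_of_eq h, h, pow_succ]; ring

lemma Generic.spec_phi_last_ne_one (h : Generic (n + 1) q t) (u : Fin (n + 1) → ℕ) :
    spec q t (phi u) (Fin.last n) ≠ 1 := by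
  rw [spec, phi_last]
  exact h.ne_one (by omega) (tExp_lt _ _)

/-- The value `𝖬_u(⟨u⟩)` in closed form. -/
def tau (q t : ℂ) (u : Fin n → ℕ) : ℂ :=
  ∏ i, ∏ j ∈ Finset.range (u i), (-(q ^ j * t ^ tExp u i))

lemma Generic.tau_ne_zero (h : Generic n q t) (u : Fin n → ℕ) : tau q t u ≠ 0 :=
  Finset.prod_ne_zero_iff.mpr fun _ _ => Finset.prod_ne_zero_iff.mpr fun _ _ =>
    neg_ne_zero.mpr (mul_ne_zero (pow_ne_zero _ h.1) (pow_ne_zero _ h.3))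

lemma tau_phi (u : Fin (n + 1) → ℕ) :
    tau q t (phi u) = -(q ^ u 0 * t ^ tExp u 0) * tau q t u := by
  rw [tau, tau, Fin.prod_univ_castSucc, Fin.prod_univ_succ]
  simp only [phi_castSucc, phi_last, tExp_phi_castSucc, tExp_phi_last, Finset.prod_range_succ]
  ring

lemma tau_addZero (u : Fin n → ℕ) : tau q t (addZero u) = t ^ size u * tau q t u := by
  rw [tau, tau, Fin.prod_univ_castSucc, size, ← Finset.prod_pow_eq_pow_sum,
    ← Finset.prod_mul_distrib]
  simp only [addZero_castSucc, addZero_last, tExp_addZero_castSucc, Finset.range_zero,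
    Finset.prod_empty, mul_one]
  refine Finset.prod_congr rfl fun i _ => ?_
  rw [← Finset.card_range (u i), ← Finset.prod_const, Finset.card_range, ← Finset.prod_mul_distrib]
  exact Finset.prod_congr rfl fun j _ => by rw [pow_succ]; ring

section PolynomialPart

open MvPolynomial

/-! ### Substitutions, degrees and divisibility -/

section Polynomials

variable {σ τ : Type*}

lemma totalDegree_aeval_le (g : σ → MvPolynomial τ ℂ) (hg : ∀ i, (g i).totalDegree ≤ 1)
    (P : MvPolynomial σ ℂ) : (aeval g P).totalDegree ≤ P.totalDegree := by
  rw [aeval_def, eval₂_eq]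
  refine totalDegree_finsetSum_le fun d hd => ?_
  refine (totalDegree_mul _ _).trans ?_
  rw [algebraMap_eq, totalDegree_C, zero_add]
  refine (totalDegree_finsetProd _ _).trans ((Finset.sum_le_sum fun i _ => ?_).trans
    (le_totalDegree hd))
  refine (totalDegree_pow _ _).trans ?_
  simpa using Nat.mul_le_mul_left (d i) (hg i)

/-- Modulo `D` the two substitutions agree on the variables. This yields the divisions by `xₙ - 1`,
by `xₖ - xₖ₊₁` and by `xᵢ`. -/
lemma dvd_aeval_sub_aeval {D : MvPolynomial τ ℂ} {g h : σ → MvPolynomial τ ℂ}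
    (hD : ∀ i, D ∣ g i - h i) (P : MvPolynomial σ ℂ) : D ∣ aeval g P - aeval h P := by
  have : (Ideal.Quotient.mkₐ ℂ (Ideal.span {D})).comp (aeval g) =
      (Ideal.Quotient.mkₐ ℂ (Ideal.span {D})).comp (aeval h) := by
    refine algHom_ext fun i => ?_
    simpa [Ideal.Quotient.eq, Ideal.mem_span_singleton] using hD i
  simpa [Ideal.Quotient.eq, Ideal.mem_span_singleton] using DFunLike.congr_fun this P

lemma totalDegree_X_sub_of_lt {i : σ} {g : MvPolynomial σ ℂ} (h : g.totalDegree = 0) :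
    (X i - g).totalDegree = 1 := by
  rw [sub_eq_add_neg, totalDegree_add_eq_left_of_totalDegree_lt, totalDegree_X]
  simp [h]

lemma X_sub_C_ne_zero (i : σ) (c : ℂ) : (X i - C c : MvPolynomial σ ℂ) ≠ 0 := by
  intro h
  have := totalDegree_X_sub_of_lt (i := i) (totalDegree_C c)
  simp [h] at this

lemma totalDegree_X_sub_C_mul {i : σ} {c : ℂ} {G : MvPolynomial σ ℂ} (h : G ≠ 0) :
    ((X i - C c) * G).totalDegree = G.totalDegree + 1 := by
  rw [totalDegree_mul_of_isDomain (X_sub_C_ne_zero i c) h,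
    totalDegree_X_sub_of_lt (totalDegree_C c), add_comm]

/-- Rescaling the variables. -/
def scale (c : σ → ℂ) : MvPolynomial σ ℂ →ₐ[ℂ] MvPolynomial σ ℂ := aeval fun i => C (c i) * X i

lemma totalDegree_C_mul_X_le (c : ℂ) (i : σ) : (C c * X i : MvPolynomial σ ℂ).totalDegree ≤ 1 :=
  (totalDegree_mul _ _).trans (by simp)

lemma totalDegree_scale_le (c : σ → ℂ) (P : MvPolynomial σ ℂ) :
    (scale c P).totalDegree ≤ P.totalDegree :=
  totalDegree_aeval_le _ (fun _ => totalDegree_C_mul_X_le _ _) P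

lemma eval_scale (c x : σ → ℂ) (P : MvPolynomial σ ℂ) :
    eval x (scale c P) = eval (fun i => c i * x i) P := by
  have : (aeval x).comp (scale c) = aeval (fun i => c i * x i) :=
    algHom_ext fun i => by simp [scale]
  simpa [aeval_eq_eval] using DFunLike.congr_fun this P

lemma coeff_scale [Fintype σ] (c : σ → ℂ) (P : MvPolynomial σ ℂ) (m : σ →₀ ℕ) :
    coeff m (scale c P) = (∏ i, c i ^ m i) * coeff m P := by
  classical
  induction P using MvPolynomial.induction_on' with
  | add p q hp hq => simp [hp, hq, mul_add]
  | monomial d a =>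
    have : scale c (monomial d a) = monomial d ((∏ i, c i ^ d i) * a) := by
      rw [scale, aeval_monomial, Finsupp.prod_fintype _ _ (by simp), algebraMap_eq]
      simp only [mul_pow, Finset.prod_mul_distrib, ← map_pow, ← map_prod]
      rw [← mul_assoc, ← C_mul, mul_comm a, monomial_eq, Finsupp.prod_fintype _ _ (by simp)]
    rw [this, coeff_monomial, coeff_monomial]
    split_ifs with h
    · rw [h]
    · simp

end Polynomials

/-! ### Polynomial counterparts of the two moves -/

section Last

/-- Restriction of a polynomial to `xₙ₊₁ = 1`. -/
def restrictLast : MvPolynomial (Fin (n + 1)) ℂ →ₐ[ℂ] MvPolynomial (Fin n) ℂ :=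
  aeval (Fin.snoc (α := fun _ => MvPolynomial (Fin n) ℂ) X 1)

lemma totalDegree_restrictLast_le (P : MvPolynomial (Fin (n + 1)) ℂ) :
    (restrictLast P).totalDegree ≤ P.totalDegree := by
  refine totalDegree_aeval_le _ (fun i => ?_) P
  refine Fin.lastCases ?_ (fun i => ?_) i <;> simp

lemma eval_restrictLast (x : Fin n → ℂ) (P : MvPolynomial (Fin (n + 1)) ℂ) :
    eval x (restrictLast P) = eval (Fin.snoc (α := fun _ => ℂ) x 1) P := by
  have : (aeval x).comp restrictLast = aeval (Fin.snoc (α := fun _ => ℂ) x 1) :=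
    algHom_ext fun i => by
      refine Fin.lastCases ?_ (fun i => ?_) i <;> simp [restrictLast]
  simpa [aeval_eq_eval] using DFunLike.congr_fun this P

lemma exists_eq_restrictLast_add (P : MvPolynomial (Fin (n + 1)) ℂ) :
    ∃ G, P = rename Fin.castSucc (restrictLast P) + (X (Fin.last n) - C 1) * G ∧
      (G = 0 ∨ G.totalDegree + 1 ≤ P.totalDegree) := by
  have hr : rename Fin.castSucc (restrictLast P) =
      aeval (Fin.snoc (α := fun _ => MvPolynomial (Fin (n + 1)) ℂ)
        (fun i : Fin n => X i.castSucc) 1) P := by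
    have : (rename Fin.castSucc).comp restrictLast =
      aeval (Fin.snoc (α := fun _ => MvPolynomial (Fin (n + 1)) ℂ)
        (fun i : Fin n => (X i.castSucc : MvPolynomial (Fin (n + 1)) ℂ)) 1) :=
      algHom_ext fun i => by
        refine Fin.lastCases ?_ (fun i => ?_) i <;> simp [restrictLast]
    exact DFunLike.congr_fun this P
  have hd : (X (Fin.last n) - C 1 : MvPolynomial (Fin (n + 1)) ℂ) ∣
      aeval X P - rename Fin.castSucc (restrictLast P) := by
    rw [hr]
    refine dvd_aeval_sub_aeval (fun i => ?_) P
    refine Fin.lastCases ?_ (fun i => ?_) i <;> simp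
  obtain ⟨G, hG⟩ := hd
  rw [aeval_X_left_apply] at hG
  refine ⟨G, by rw [← hG]; ring, ?_⟩
  rcases eq_or_ne G 0 with h | h
  · exact Or.inl h
  · right
    rw [← totalDegree_X_sub_C_mul (i := Fin.last n) (c := 1) h, ← hG]
    exact (totalDegree_sub _ _).trans (max_le le_rfl
      ((totalDegree_rename_le _ _).trans (totalDegree_restrictLast_le P)))

/-- The substitution `f(x) ↦ f(xₙ₊₁ / q, x₁, …, xₙ)`. -/
def rotate (q : ℂ) : MvPolynomial (Fin (n + 1)) ℂ →ₐ[ℂ] MvPolynomial (Fin (n + 1)) ℂ :=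
  aeval (Fin.cons (α := fun _ => MvPolynomial (Fin (n + 1)) ℂ) (C q⁻¹ * X (Fin.last n))
    fun i => X i.castSucc)

lemma totalDegree_rotate_le (P : MvPolynomial (Fin (n + 1)) ℂ) :
    (rotate q P).totalDegree ≤ P.totalDegree := by
  refine totalDegree_aeval_le _ (fun i => ?_) P
  refine Fin.cases ?_ (fun i => ?_) i
  · exact totalDegree_C_mul_X_le _ _
  · simp

lemma eval_rotate (x : Fin (n + 1) → ℂ) (P : MvPolynomial (Fin (n + 1)) ℂ) :
    eval x (rotate q P) =
      eval (Fin.cons (α := fun _ => ℂ) (q⁻¹ * x (Fin.last n)) fun i => x i.castSucc) P := by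
  have : (aeval x).comp (rotate q) =
      aeval (Fin.cons (α := fun _ => ℂ) (q⁻¹ * x (Fin.last n)) fun i => x i.castSucc) :=
    algHom_ext fun i => by
      refine Fin.cases ?_ (fun i => ?_) i <;> simp [rotate]
  simpa [aeval_eq_eval] using DFunLike.congr_fun this P

lemma eval_spec_phi_rotate (hq : q ≠ 0) (u : Fin (n + 1) → ℕ) (P : MvPolynomial (Fin (n + 1)) ℂ) :
    eval (spec q t (phi u)) (rotate q P) = eval (spec q t u) P := by
  rw [eval_rotate]
  congr 2
  funext i
  refine Fin.cases ?_ (fun i => ?_) i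
  · simp [spec_phi_last, hq]
  · simp [spec_phi_castSucc]

lemma rotate_eq_scale_rename (P : MvPolynomial (Fin (n + 1)) ℂ) :
    rotate q P = scale (Fin.snoc (α := fun _ => ℂ) (fun _ => 1) q⁻¹)
      (rename (finRotate (n + 1)).symm P) := by
  have : rotate q = (scale (Fin.snoc (α := fun _ => ℂ) (fun _ => 1) q⁻¹)).comp
      (rename (finRotate (n + 1)).symm) := by
    refine algHom_ext fun i => ?_
    refine Fin.cases ?_ (fun i => ?_) i
    · have : (finRotate (n + 1)).symm 0 = Fin.last n := by
        rw [Equiv.symm_apply_eq, finRotate_last]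
      simp [rotate, scale, -finRotate_symm_apply, this]
    · have : (finRotate (n + 1)).symm i.succ = i.castSucc := by
        rw [Equiv.symm_apply_eq]; simp
      simp [rotate, scale, -finRotate_symm_apply, this]
  exact DFunLike.congr_fun this P

lemma coeff_rotate (u : Fin (n + 1) → ℕ) (P : MvPolynomial (Fin (n + 1)) ℂ) :
    coeff (Finsupp.equivFunOnFinite.symm (Fin.snoc (α := fun _ => ℕ) (Fin.tail u) (u 0)))
      (rotate q P) = q⁻¹ ^ u 0 * coeff (Finsupp.equivFunOnFinite.symm u) P := by
  have hm : Finsupp.equivFunOnFinite.symm (Fin.snoc (α := fun _ => ℕ) (Fin.tail u) (u 0)) =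
      Finsupp.mapDomain (finRotate (n + 1)).symm (Finsupp.equivFunOnFinite.symm u) := by
    ext i
    rw [Finsupp.mapDomain_equiv_apply]
    refine Fin.lastCases ?_ (fun i => ?_) i
    · simp
    · simp [Fin.tail]
  rw [rotate_eq_scale_rename, coeff_scale, hm, coeff_rename_mapDomain _ (Equiv.injective _),
    ← hm, Fin.prod_univ_castSucc]
  simp

lemma eval_spec_addZero (u : Fin n → ℕ) (P : MvPolynomial (Fin (n + 1)) ℂ) :
    eval (spec q t (addZero u)) P =
      eval (spec q t u) (scale (fun _ => t) (restrictLast P)) := by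
  rw [eval_scale, eval_restrictLast]
  congr 2
  funext i
  refine Fin.lastCases ?_ (fun i => ?_) i
  · simp [spec_addZero_last]
  · simp [spec_addZero_castSucc]

end Last

/-! ### Interpolation at spectral vectors and the dual polynomials -/

section Unisolvence

lemma scale_eq_zero {σ : Type*} {c : ℂ} (hc : c ≠ 0) {P : MvPolynomial σ ℂ}
    (h : scale (fun _ => c) P = 0) : P = 0 := by
  have : (scale fun _ : σ => c⁻¹).comp (scale fun _ => c) = AlgHom.id ℂ _ :=
    algHom_ext fun i => by simp [scale, ← mul_assoc, ← C_mul, hc]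
  have h2 := DFunLike.congr_fun this P
  simpa [h] using h2.symm

lemma eq_rotate (hq : q ≠ 0) (G : MvPolynomial (Fin (n + 1)) ℂ) :
    ∃ F, G = rotate q F ∧ F.totalDegree ≤ G.totalDegree := by
  refine ⟨aeval (Fin.snoc (α := fun _ => MvPolynomial (Fin (n + 1)) ℂ)
    (fun i : Fin n => X i.succ) (C q * X 0)) G, ?_, ?_⟩
  · have : (rotate q).comp (aeval (Fin.snoc (α := fun _ => MvPolynomial (Fin (n + 1)) ℂ)
        (fun i : Fin n => X i.succ) (C q * X 0))) = AlgHom.id ℂ _ := by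
      refine algHom_ext fun i => ?_
      refine Fin.lastCases ?_ (fun i => ?_) i
      · simp [rotate, ← mul_assoc, ← C_mul, hq]
      · simp [rotate]
    exact (DFunLike.congr_fun this G).symm
  · refine totalDegree_aeval_le _ (fun i => ?_) G
    refine Fin.lastCases ?_ (fun i => ?_) i
    · simpa using totalDegree_C_mul_X_le q 0
    · simp

/-- The compositions ending in `0` kill the restriction to `xₙ = 1`. The quotient by `xₙ - 1`,
rotated back, has smaller degree and vanishes at all smaller compositions. -/
lemma eq_zero_of_eval_spec_eq_zero (h : Generic n q t) (d : ℕ) (P : MvPolynomial (Fin n) ℂ)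
    (hP : P.totalDegree ≤ d) (h0 : ∀ v : Fin n → ℕ, size v ≤ d → eval (spec q t v) P = 0) :
    P = 0 := by
  induction n generalizing d with
  | zero =>
    rw [eq_C_of_isEmpty P] at h0 ⊢
    simpa using h0 0 (by simp [size])
  | succ n ihn =>
    induction d generalizing P with
    | zero =>
      have hr : restrictLast P = 0 := by
        refine scale_eq_zero h.3 (ihn h.pred 0 _ ((totalDegree_scale_le _ _).trans
          ((totalDegree_restrictLast_le P).trans hP)) fun v hv => ?_)
        rw [← eval_spec_addZero]
        exact h0 _ (by simpa using hv)
      obtain ⟨G, hG, hG' | hG'⟩ := exists_eq_restrictLast_add P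
      · rw [hG, hG', hr]; simp
      · omega
    | succ d ihd =>
      have hr : restrictLast P = 0 := by
        refine scale_eq_zero h.3 (ihn h.pred (d + 1) _ ((totalDegree_scale_le _ _).trans
          ((totalDegree_restrictLast_le P).trans hP)) fun v hv => ?_)
        rw [← eval_spec_addZero]
        exact h0 _ (by simpa using hv)
      obtain ⟨G, hG, hG' | hG'⟩ := exists_eq_restrictLast_add P
      · rw [hG, hG', hr]; simp
      · obtain ⟨F, rfl, hF⟩ := eq_rotate h.1 G
        rw [hr, map_zero, zero_add] at hG
        have : F = 0 := by
          refine ihd F (by omega) fun v hv => ?_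
          have := h0 (phi v) (by simpa using hv)
          rw [hG, map_mul, eval_spec_phi_rotate h.1] at this
          refine (mul_eq_zero.mp this).resolve_left ?_
          simpa [sub_eq_zero] using h.spec_phi_last_ne_one v
        rw [hG, this]; simp

lemma eq_of_eval_spec_eq (h : Generic n q t) {d : ℕ} {P Q : MvPolynomial (Fin n) ℂ}
    (hP : P.totalDegree ≤ d) (hQ : Q.totalDegree ≤ d)
    (h0 : ∀ v : Fin n → ℕ, size v ≤ d → eval (spec q t v) P = eval (spec q t v) Q) : P = Q :=
  sub_eq_zero.mp <| eq_zero_of_eval_spec_eq_zero h d _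
    ((totalDegree_sub _ _).trans (max_le hP hQ)) fun v hv => by simp [h0 v hv]

lemma exists_eval_spec_eq (h : Generic n q t) (d : ℕ) (g : (Fin n → ℕ) → ℂ) :
    ∃ P : MvPolynomial (Fin n) ℂ, P.totalDegree ≤ d ∧
      ∀ v : Fin n → ℕ, size v ≤ d → eval (spec q t v) P = g v := by
  induction n generalizing d with
  | zero => exact ⟨C (g 0), by simp, fun v _ => by simp [Subsingleton.elim v 0]⟩
  | succ n ihn =>
    have key : ∀ (d : ℕ) (g : (Fin (n + 1) → ℕ) → ℂ), ∃ P : MvPolynomial (Fin (n + 1)) ℂ,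
        P.totalDegree ≤ d ∧ ∀ v : Fin n → ℕ, size v ≤ d →
          eval (spec q t (addZero v)) P = g (addZero v) := by
      intro d g
      obtain ⟨P', hP', hP'g⟩ := ihn h.pred d fun v => g (addZero v)
      -- Appending a zero multiplies the old spectral coordinates by `t`; the factor `t⁻¹` undoes
      -- this.
      refine ⟨rename Fin.castSucc (scale (fun _ => t⁻¹) P'), (totalDegree_rename_le _ _).trans
        ((totalDegree_scale_le _ _).trans hP'), fun v hv => ?_⟩
      rw [eval_rename, eval_scale, ← hP'g v hv]
      congr 2
      funext i
      simp [spec_addZero_castSucc, h.3]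
    induction d generalizing g with
    | zero =>
      obtain ⟨P₁, hdeg, hval⟩ := key 0 g
      refine ⟨P₁, hdeg, fun v hv => ?_⟩
      rcases eq_addZero_or_eq_phi v with ⟨w, rfl⟩ | ⟨w, rfl⟩
      · exact hval w (by simpa using hv)
      · simp at hv
    | succ d ihd =>
      obtain ⟨P₁, hdeg, hval⟩ := key (d + 1) g
      -- `P₁` is right on compositions ending in `0`. A multiple of `xₙ - 1` does not disturb this,
      -- and `F` is chosen to remove the error at each `phi v`.
      obtain ⟨F, hF, hFg⟩ := ihd fun v =>
        (g (phi v) - eval (spec q t (phi v)) P₁) / (spec q t (phi v) (Fin.last n) - 1)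
      refine ⟨P₁ + (X (Fin.last n) - C 1) * rotate q F, ?_, fun v hv => ?_⟩
      · refine (totalDegree_add _ _).trans (max_le hdeg ?_)
        refine (totalDegree_mul _ _).trans ?_
        rw [totalDegree_X_sub_of_lt (totalDegree_C 1), add_comm]
        exact Nat.add_le_add_right ((totalDegree_rotate_le F).trans hF) 1
      · rcases eq_addZero_or_eq_phi v with ⟨w, rfl⟩ | ⟨w, rfl⟩
        · simp [spec_addZero_last, hval w (by simpa using hv)]
        · have hne := sub_ne_zero.mpr (h.spec_phi_last_ne_one w)
          rw [map_add, map_mul, eval_spec_phi_rotate h.1, hFg w (by simpa using hv)]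
          simp [mul_div_cancel₀ _ hne]

/-- A polynomial of degree at most `|u|` taking the value `1` at `⟨u⟩` and vanishing at all other
`⟨v⟩` with `|v| ≤ |u|`. -/
structure IsDual (q t : ℂ) (u : Fin n → ℕ) (P : MvPolynomial (Fin n) ℂ) : Prop where
  totalDegree_le : P.totalDegree ≤ size u
  eval_self : eval (spec q t u) P = 1
  eval_eq_zero : ∀ v : Fin n → ℕ, size v ≤ size u → v ≠ u → eval (spec q t v) P = 0

lemma Generic.exists_isDual (h : Generic n q t) (u : Fin n → ℕ) : ∃ P, IsDual q t u P := by
  classical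
  obtain ⟨P, hP, hv⟩ := exists_eval_spec_eq h (size u) fun v => if v = u then 1 else 0
  exact ⟨P, hP, by simpa using hv u le_rfl, fun v hvu hne => by simpa [hne] using hv v hvu⟩

lemma IsDual.eq_smul (h : Generic n q t) {u : Fin n → ℕ} {E P : MvPolynomial (Fin n) ℂ}
    (hE : IsDual q t u E) (hd : P.totalDegree ≤ size u)
    (h0 : ∀ v : Fin n → ℕ, size v ≤ size u → v ≠ u → eval (spec q t v) P = 0) :
    P = C (eval (spec q t u) P) * E := by
  refine eq_of_eval_spec_eq h hd ((totalDegree_mul _ _).trans (by simpa using hE.1)) fun v hv => ?_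
  by_cases hvu : v = u
  · subst hvu; simp [hE.2]
  · simp [h0 v hv hvu, hE.3 v hv hvu]

lemma coeff_addZero {u : Fin n → ℕ} {P : MvPolynomial (Fin (n + 1)) ℂ}
    (hP : P.totalDegree ≤ size u) :
    coeff (Finsupp.equivFunOnFinite.symm (addZero u)) P =
      coeff (Finsupp.equivFunOnFinite.symm u) (restrictLast P) := by
  classical
  have hm : Finsupp.equivFunOnFinite.symm (addZero u) =
      Finsupp.mapDomain Fin.castSucc (Finsupp.equivFunOnFinite.symm u) := by
    ext i
    refine Fin.lastCases ?_ (fun i => ?_) i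
    · rw [Finsupp.mapDomain_of_notMem_range _ _ (by simp)]
      simp
    · rw [Finsupp.mapDomain_apply (Fin.castSucc_injective n)]
      simp
  obtain ⟨G, hG, hG'⟩ := exists_eq_restrictLast_add P
  have h0 : coeff (Finsupp.equivFunOnFinite.symm (addZero u)) G = 0 := by
    rcases hG' with rfl | hG'
    · simp
    · refine coeff_eq_zero_of_totalDegree_lt ?_
      rw [← Finsupp.degree_apply, Finsupp.degree_eq_sum]
      refine lt_of_lt_of_le hG' (hP.trans ?_)
      rw [← size_addZero]
      simp [size]
  conv_lhs => rw [hG]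
  rw [coeff_add, sub_mul, coeff_sub, coeff_C_mul, h0, coeff_X_mul', if_neg (by simp)]
  rw [hm, coeff_rename_mapDomain _ (Fin.castSucc_injective n)]
  simp

/-- The degree bound leaves no room for this exponent in `G` itself, so only the product with `xₙ`
contributes. -/
lemma coeff_phi {u : Fin (n + 1) → ℕ} {G : MvPolynomial (Fin (n + 1)) ℂ}
    (hG : G.totalDegree ≤ size u) :
    coeff (Finsupp.equivFunOnFinite.symm (phi u)) ((X (Fin.last n) - C 1) * G) =
      coeff (Finsupp.equivFunOnFinite.symm (Fin.snoc (α := fun _ => ℕ) (Fin.tail u) (u 0))) G := by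
  have hm : Finsupp.equivFunOnFinite.symm (phi u) = Finsupp.single (Fin.last n) 1 +
      Finsupp.equivFunOnFinite.symm (Fin.snoc (α := fun _ => ℕ) (Fin.tail u) (u 0)) := by
    ext i
    refine Fin.lastCases ?_ (fun i => ?_) i
    · simp [add_comm]
    · simp [Fin.tail]
  have h0 : coeff (Finsupp.equivFunOnFinite.symm (phi u)) G = 0 := by
    refine coeff_eq_zero_of_totalDegree_lt ?_
    rw [← Finsupp.degree_apply, Finsupp.degree_eq_sum]
    refine lt_of_lt_of_le (Nat.lt_succ_of_le hG) ?_
    rw [Nat.succ_eq_add_one, ← size_phi]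
    simp [size]
  rw [sub_mul, coeff_sub, coeff_C_mul, h0, hm, coeff_X_mul]
  simp

lemma IsDual.restrictLast {u : Fin n → ℕ} {E : MvPolynomial (Fin (n + 1)) ℂ}
    (hE : IsDual q t (addZero u) E) :
    IsDual q t u (scale (fun _ => t) (restrictLast E)) where
  totalDegree_le := (totalDegree_scale_le _ _).trans
    ((totalDegree_restrictLast_le E).trans (by simpa using hE.1))
  eval_self := by rw [← eval_spec_addZero, hE.2]
  eval_eq_zero v hv hne := by
    rw [← eval_spec_addZero]
    exact hE.3 _ (by simpa using hv) (addZero_injective.ne hne)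

/-- The factor `xₙ - 1` vanishes at compositions ending in `0`, and rotation carries the values at
`⟨w⟩` to `⟨φ(w)⟩`. The product thus has the zeros of `E`, and uniqueness leaves only a scalar. -/
lemma IsDual.eq_rotate (h : Generic (n + 1) q t) {u : Fin (n + 1) → ℕ}
    {E F : MvPolynomial (Fin (n + 1)) ℂ} (hE : IsDual q t (phi u) E) (hF : IsDual q t u F) :
    E = C (spec q t (phi u) (Fin.last n) - 1)⁻¹ * ((X (Fin.last n) - C 1) * rotate q F) := by
  have hne := sub_ne_zero.mpr (h.spec_phi_last_ne_one u)
  have := hE.eq_smul h (P := (X (Fin.last n) - C 1) * rotate q F) ?_ fun v hv hvu => ?_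
  · rw [this, map_mul, eval_spec_phi_rotate h.1, hF.2]
    rw [← mul_assoc, ← C_mul]
    simp [hne]
  · refine (totalDegree_mul _ _).trans ?_
    rw [totalDegree_X_sub_of_lt (totalDegree_C 1), add_comm, size_phi]
    exact Nat.add_le_add_right ((totalDegree_rotate_le F).trans hF.1) 1
  · rcases eq_addZero_or_eq_phi v with ⟨w, rfl⟩ | ⟨w, rfl⟩
    · simp [spec_addZero_last]
    · rw [map_mul, eval_spec_phi_rotate h.1, hF.3 w (by simpa using hv) (fun h => hvu (by rw [h])),
        mul_zero]

lemma IsDual.coeff_self (h : Generic n q t) {u : Fin n → ℕ} {E : MvPolynomial (Fin n) ℂ}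
    (hE : IsDual q t u E) : coeff (Finsupp.equivFunOnFinite.symm u) E =
      t ^ legSum u / (cPrime q t u * tau q t u) := by
  induction n with
  | zero =>
    have h1 := hE.2
    rw [eq_C_of_isEmpty E] at h1 ⊢
    have : Finsupp.equivFunOnFinite.symm u = 0 := Subsingleton.elim _ _
    simp only [eval_C] at h1
    simp [this, legSum, cPrime, tau, h1]
  | succ n ihn =>
    have key : ∀ (u : Fin n → ℕ) (E : MvPolynomial (Fin (n + 1)) ℂ), IsDual q t (addZero u) E →
        coeff (Finsupp.equivFunOnFinite.symm (addZero u)) E =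
          t ^ legSum (addZero u) / (cPrime q t (addZero u) * tau q t (addZero u)) := by
      intro u E hE
      have h1 := ihn h.pred hE.restrictLast
      rw [coeff_scale, Finset.prod_pow_eq_pow_sum] at h1
      rw [coeff_addZero (by simpa using hE.1), legSum_addZero, cPrime_addZero, tau_addZero]
      have hs : t ^ size u ≠ 0 := pow_ne_zero _ h.3
      have hc := h.pred.cPrime_ne_zero u
      have ht := h.pred.tau_ne_zero u
      -- The power of `t` produced by rescaling the variables is the one in `tau_addZero`.
      change t ^ size u * _ = _ at h1
      field_simp at h1 ⊢
      linear_combination h1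
    induction hs : size u generalizing u E with
    | zero =>
      rcases eq_addZero_or_eq_phi u with ⟨w, rfl⟩ | ⟨w, rfl⟩
      · exact key w E hE
      · simp at hs
    | succ d ihd =>
      rcases eq_addZero_or_eq_phi u with ⟨w, rfl⟩ | ⟨w, rfl⟩
      · exact key w E hE
      · obtain ⟨F, hF⟩ := h.exists_isDual w
        have h1 := ihd hF (by simpa using hs)
        have hc := h.cPrime_ne_zero w
        have ht := h.tau_ne_zero w
        have hne := sub_ne_zero.mpr (h.spec_phi_last_ne_one w)
        have hne' : 1 - q ^ (w 0 + 1) * t ^ tExp w 0 ≠ 0 := by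
          intro h0; apply hne; simp only [spec, phi_last, tExp_phi_last]; linear_combination -h0
        rw [hE.eq_rotate h hF, coeff_C_mul, coeff_phi ((totalDegree_rotate_le F).trans hF.1),
          coeff_rotate, h1, legSum_phi, cPrime_phi, tau_phi]
        simp only [spec, phi_last, tExp_phi_last] at hne ⊢
        have hq := pow_ne_zero (w 0) h.1
        have ht' := pow_ne_zero (tExp w 0) h.3
        -- The scalar in the recursion is, up to sign, the inverse of the new factor of `cPrime`;
        -- the sign and the power of `q` from rotation match the new factor of `tau`, whose power of
        -- `t` cancels the new leg.
        rw [show q ^ (w 0 + 1) * t ^ tExp w 0 - 1 = -(1 - q ^ (w 0 + 1) * t ^ tExp w 0) by ring,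
          pow_add, inv_pow, inv_neg]
        field_simp
        ring

/-- The interpolation polynomial of `u` is a multiple of the dual polynomial of `u`. -/
lemma IsDual.isInterpolation_iff (h : Generic n q t) {u : Fin n → ℕ} {E : MvPolynomial (Fin n) ℂ}
    (hE : IsDual q t u E) (P : MvPolynomial (Fin n) ℂ) : IsInterpolation q t u P ↔
      P = C (cPrime q t u * tau q t u / (q ^ armSum u * t ^ legSum u)) * E := by
  have hc := h.cPrime_ne_zero u
  have ht := h.tau_ne_zero u
  have hq : q ^ armSum u ≠ 0 := pow_ne_zero _ h.1
  have ht' : t ^ legSum u ≠ 0 := pow_ne_zero _ h.3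
  constructor
  · rintro ⟨h1, h2, h3⟩
    have h4 := hE.eq_smul h h1.le h2
    rw [h4]
    rw [h4, coeff_C_mul, hE.coeff_self h] at h3
    congr 2
    field_simp at h3 ⊢
    linear_combination h3
  · rintro rfl
    have h3 : coeff (Finsupp.equivFunOnFinite.symm u)
        (C (cPrime q t u * tau q t u / (q ^ armSum u * t ^ legSum u)) * E) =
          (q ^ armSum u)⁻¹ := by
      rw [coeff_C_mul, hE.coeff_self h]
      field_simp
    refine ⟨le_antisymm ((totalDegree_mul _ _).trans (by simpa using hE.1)) ?_, ?_, h3⟩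
    · have hmem := mem_support_iff.mpr (h3.trans_ne (inv_ne_zero hq))
      refine le_trans (le_of_eq ?_) (le_totalDegree hmem)
      rw [Finsupp.sum_fintype _ _ (by simp)]
      simp [size]
    · intro v hv hne
      simp [hE.3 v hv hne]

lemma Generic.existsUnique_isInterpolation (h : Generic n q t) (u : Fin n → ℕ) :
    ∃! P : MvPolynomial (Fin n) ℂ, IsInterpolation q t u P := by
  obtain ⟨E, hE⟩ := h.exists_isDual u
  exact ⟨_, (hE.isInterpolation_iff h _).mpr rfl, fun P hP => (hE.isInterpolation_iff h P).mp hP⟩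

lemma IsDual.normM_eq (h : Generic n q t) {u : Fin n → ℕ} {E : MvPolynomial (Fin n) ℂ}
    (hE : IsDual q t u E) (x : Fin n → ℂ) : normM q t u x = tau q t u * eval x E := by
  have hM : IsInterpolation q t u (M q t u) := by
    have := (h.existsUnique_isInterpolation u).exists
    rw [M, dif_pos this]
    exact this.choose_spec
  have hc := h.cPrime_ne_zero u
  have hq : q ^ armSum u ≠ 0 := pow_ne_zero _ h.1
  have ht' : t ^ legSum u ≠ 0 := pow_ne_zero _ h.3
  rw [normM, (hE.isInterpolation_iff h _).mp hM, map_mul, eval_C]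
  field_simp

/-- The dual polynomial of `u`, that is, `𝖬_u / 𝖬_u(⟨u⟩)`. -/
def Generic.dual (h : Generic n q t) (u : Fin n → ℕ) : MvPolynomial (Fin n) ℂ :=
  (h.exists_isDual u).choose

lemma Generic.isDual_dual (h : Generic n q t) (u : Fin n → ℕ) : IsDual q t u (h.dual u) :=
  (h.exists_isDual u).choose_spec

lemma Generic.normM_eq (h : Generic n q t) (u : Fin n → ℕ) (x : Fin n → ℂ) :
    normM q t u x = tau q t u * eval x (h.dual u) := (h.isDual_dual u).normM_eq h x

lemma Generic.normM_spec_self (h : Generic n q t) (u : Fin n → ℕ) :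
    normM q t u (spec q t u) = tau q t u := by
  rw [h.normM_eq, (h.isDual_dual u).2, mul_one]

lemma Generic.qbinom_eq (h : Generic n q t) (u v : Fin n → ℕ) :
    qbinom q t u v = eval (spec q t u) (h.dual v) := by
  rw [qbinom, h.normM_spec_self, h.normM_eq, mul_div_cancel_left₀ _ (h.tau_ne_zero v)]

/-- The dual polynomial of the larger composition separates the two points. -/
lemma Generic.spec_injective (h : Generic n q t) : Function.Injective (spec (n := n) q t) := by
  have key : ∀ u v : Fin n → ℕ, size v ≤ size u → spec q t u = spec q t v → u = v := by
    intro u v hs he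
    by_contra hne
    have h1 := (h.isDual_dual u).2
    rw [he, (h.isDual_dual u).3 v hs (Ne.symm hne)] at h1
    exact zero_ne_one h1
  intro u v he
  rcases le_total (size v) (size u) with hs | hs
  · exact key u v hs he
  · exact (key v u hs he.symm).symm

end Unisolvence

/-! ### Extra vanishing through eigenoperators -/

section Vanishing

/-- Containment of compositions up to a permutation of positions preserving the ranks. -/
def Sub (v w : Fin n → ℕ) : Prop :=
  ∃ σ : Equiv.Perm (Fin n), ∀ i, v i ≤ w (σ i) ∧ tExp v i = tExp w (σ i)

lemma Sub.refl (v : Fin n → ℕ) : Sub v v := ⟨1, fun _ => ⟨le_rfl, rfl⟩⟩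

lemma Sub.trans {u v w : Fin n → ℕ} : Sub u v → Sub v w → Sub u w := by
  rintro ⟨σ, hσ⟩ ⟨ρ, hρ⟩
  exact ⟨σ.trans ρ, fun i => ⟨(hσ i).1.trans (hρ (σ i)).1, (hσ i).2.trans (hρ (σ i)).2⟩⟩

lemma sub_adj {w : Fin (n + 1) → ℕ} {k : Fin n} (h : w k.castSucc ≠ w k.succ) :
    Sub (w ∘ adj k) w :=
  ⟨adj k, fun i => ⟨le_rfl, tExp_adj h i⟩⟩

lemma sub_phi (w : Fin (n + 1) → ℕ) : Sub w (phi w) := by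
  refine ⟨(finRotate (n + 1)).symm, fun i => ?_⟩
  refine Fin.cases ?_ (fun i => ?_) i
  · have : (finRotate (n + 1)).symm 0 = Fin.last n := by
      rw [Equiv.symm_apply_eq, finRotate_last]
    simp [-finRotate_symm_apply, this]
  · have : (finRotate (n + 1)).symm i.succ = i.castSucc := by
      rw [Equiv.symm_apply_eq]; simp
    simp [-finRotate_symm_apply, this]

/-- The nonvanishing of `g` at `⟨w⟩` forces that of `f` at some `⟨w'⟩`, where `w'` is contained in
`w` and `|w'| + m = |w|`. -/
def SupportLE (q t : ℂ) (m : ℕ) (f g : MvPolynomial (Fin n) ℂ) : Prop :=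
  ∀ w, eval (spec q t w) g ≠ 0 → ∃ w', size w' + m = size w ∧ Sub w' w ∧ eval (spec q t w') f ≠ 0

lemma SupportLE.refl (f : MvPolynomial (Fin n) ℂ) : SupportLE q t 0 f f :=
  fun w hw => ⟨w, by simp, Sub.refl w, hw⟩

lemma SupportLE.trans {k m : ℕ} {f g h : MvPolynomial (Fin n) ℂ} (hfg : SupportLE q t k f g)
    (hgh : SupportLE q t m g h) : SupportLE q t (k + m) f h := by
  intro w hw
  obtain ⟨w', h1, h2, h3⟩ := hgh w hw
  obtain ⟨w'', h1', h2', h3'⟩ := hfg w' h3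
  exact ⟨w'', by omega, h2'.trans h2, h3'⟩

lemma eval_rename_adj (k : Fin n) (x : Fin (n + 1) → ℂ) (f : MvPolynomial (Fin (n + 1)) ℂ) :
    eval x (rename (adj k) f) = eval (x ∘ adj k) f := eval_rename _ _ _

lemma exists_dividedDifference (k : Fin n) (f : MvPolynomial (Fin (n + 1)) ℂ) :
    ∃ D : MvPolynomial (Fin (n + 1)) ℂ,
      f - rename (adj k) f = (X k.castSucc - X k.succ) * D ∧
      (D = 0 ∨ D.totalDegree + 1 ≤ f.totalDegree) := by
  have hr : rename (adj k) f = aeval (fun i => X (adj k i)) f := by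
    have : rename (R := ℂ) (adj k) = aeval (fun i => X (adj k i)) := algHom_ext fun i => by simp
    rw [this]
  have hd : (X k.castSucc - X k.succ : MvPolynomial (Fin (n + 1)) ℂ) ∣
      aeval X f - rename (adj k) f := by
    rw [hr]
    refine dvd_aeval_sub_aeval (fun i => ?_) f
    rcases eq_or_ne i k.castSucc with rfl | h1
    · simp
    rcases eq_or_ne i k.succ with rfl | h2
    · rw [← neg_sub, neg_dvd]; simp
    · simp [Equiv.swap_apply_of_ne_of_ne h1 h2]
  obtain ⟨D, hD⟩ := hd
  rw [aeval_X_left_apply] at hD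
  have hne : (X k.castSucc - X k.succ : MvPolynomial (Fin (n + 1)) ℂ) ≠ 0 := by
    intro h0
    have := congrArg (eval (fun i => if i = k.castSucc then (1 : ℂ) else 0)) h0
    simp [(Fin.castSucc_lt_succ (i := k)).ne'] at this
  refine ⟨D, hD, ?_⟩
  rcases eq_or_ne D 0 with h0 | h0
  · exact Or.inl h0
  right
  have h1 := (totalDegree_sub f (rename (adj k) f)).trans
    (max_le le_rfl (totalDegree_rename_le _ _))
  rw [hD, totalDegree_mul_of_isDomain hne h0] at h1
  have h2 : (X k.castSucc - X k.succ : MvPolynomial (Fin (n + 1)) ℂ).totalDegree ≠ 0 := by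
    intro h2
    have hc := totalDegree_eq_zero_iff_eq_C.mp h2
    have e1 := congrArg (eval (fun i => if i = k.castSucc then (1 : ℂ) else 0)) hc
    have e2 := congrArg (eval (fun _ => (0 : ℂ))) hc
    simp only [map_sub, eval_X, eval_C, (Fin.castSucc_lt_succ (i := k)).ne', if_true, if_false]
      at e1 e2
    rw [← e2] at e1
    norm_num at e1
  omega

/-- A Demazure–Lusztig operator, described by its values. -/
lemma exists_demazureLusztig (h : Generic (n + 1) q t) (k : Fin n)
    (f : MvPolynomial (Fin (n + 1)) ℂ) : ∃ g : MvPolynomial (Fin (n + 1)) ℂ,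
      g.totalDegree ≤ f.totalDegree ∧ SupportLE q t 0 f g ∧
      ∀ x : Fin (n + 1) → ℂ, x k.castSucc = 0 → eval x g = eval (x ∘ adj k) f := by
  obtain ⟨D, hD, hD0⟩ := exists_dividedDifference k f
  have hdeg : (rename (adj k) f).totalDegree ≤ f.totalDegree := totalDegree_rename_le _ _
  have hev : ∀ x, eval x f - eval (x ∘ adj k) f =
      (x k.castSucc - x k.succ) * eval x D := by
    intro x
    have := congrArg (eval x) hD
    simpa [eval_rename_adj] using this
  have ht := h.3
  refine ⟨rename (adj k) f + C (1 - t⁻¹) * (X k.castSucc * D), ?_, ?_, ?_⟩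
  · refine (totalDegree_add _ _).trans (max_le hdeg ?_)
    rcases hD0 with rfl | hD0
    · simp
    · refine (totalDegree_mul _ _).trans ?_
      rw [totalDegree_C, zero_add]
      refine (totalDegree_mul _ _).trans ?_
      rw [totalDegree_X]
      omega
  · intro w hw
    have hE := hev (spec q t w)
    simp only [map_add, map_mul, eval_rename_adj, eval_C, eval_X] at hw
    by_cases hww : w k.castSucc = w k.succ
    -- The swapped point need not be spectral here. But `⟨w⟩ₖ = t⟨w⟩ₖ₊₁` turns `(1 - t⁻¹)xₖ` into
    -- `xₖ - xₖ₊₁`, so the value of `g` is that of `f`.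
    · refine ⟨w, by simp, Sub.refl w, fun h0 => hw ?_⟩
      rw [spec_of_eq hww] at hE hw ⊢
      rw [h0] at hE
      have : (1 - t⁻¹) * (t * spec q t w k.succ * eval (spec q t w) D) =
          (t * spec q t w k.succ - spec q t w k.succ) * eval (spec q t w) D := by
        field_simp
      rw [this, ← hE]; ring
    · by_cases h0 : eval (spec q t w) f = 0
      · refine ⟨w ∘ adj k, by simp [size_comp_perm], sub_adj hww, fun h1 => hw ?_⟩
        rw [spec_adj hww] at h1
        rw [h0, h1, sub_zero, eq_comm, mul_eq_zero, sub_eq_zero] at hE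
        rw [h1, hE.resolve_left (h.spec_ne_of_ne hww)]
        simp
      · exact ⟨w, by simp, Sub.refl w, h0⟩
  · intro x hx
    simp [eval_rename_adj, hx]

lemma insertNth_castSucc_comp_adj (k : Fin n) (y : Fin n → ℂ) :
    (Fin.insertNth (α := fun _ => ℂ) k.castSucc 0 y) ∘ adj k =
      Fin.insertNth (α := fun _ => ℂ) k.succ 0 y := by
  have hs : ∀ j, adj k (k.succ.succAbove j) = k.castSucc.succAbove j := by
    intro j
    rw [Equiv.swap_apply_def]
    simp only [Fin.ext_iff, Fin.succAbove, Fin.lt_def, Fin.val_succ, Fin.val_castSucc]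
    split_ifs <;> simp_all <;> omega
  refine (Fin.insertNth_eq_iff.mpr ⟨by simp, funext fun j => ?_⟩).symm
  simp only [Fin.removeNth, Function.comp, hs, Fin.insertNth_apply_succAbove]

/-- Moving a zero from position `i` to the last position. -/
lemma exists_moveLast (h : Generic (n + 1) q t) (i : Fin (n + 1))
    (f : MvPolynomial (Fin (n + 1)) ℂ) : ∃ g : MvPolynomial (Fin (n + 1)) ℂ,
      g.totalDegree ≤ f.totalDegree ∧ SupportLE q t 0 f g ∧
      ∀ y : Fin n → ℂ, eval (Fin.insertNth (α := fun _ => ℂ) i 0 y) g =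
        eval (Fin.snoc (α := fun _ => ℂ) y 0) f := by
  induction i using Fin.reverseInduction with
  | last => exact ⟨f, le_rfl, SupportLE.refl f, fun y => by rw [Fin.insertNth_last']⟩
  | cast k ih =>
    obtain ⟨g, h1, h2, h3⟩ := ih
    obtain ⟨g', h1', h2', h3'⟩ := exists_demazureLusztig h k g
    refine ⟨g', h1'.trans h1, h2.trans h2', fun y => ?_⟩
    rw [h3' _ (by simp), insertNth_castSucc_comp_adj, h3]

/-- Moving a zero from the first position to position `i`. -/
lemma exists_moveFirst (h : Generic (n + 1) q t) (i : Fin (n + 1))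
    (f : MvPolynomial (Fin (n + 1)) ℂ) : ∃ g : MvPolynomial (Fin (n + 1)) ℂ,
      g.totalDegree ≤ f.totalDegree ∧ SupportLE q t 0 f g ∧
      ∀ y : Fin n → ℂ, eval (Fin.cons (α := fun _ => ℂ) 0 y) g =
        eval (Fin.insertNth (α := fun _ => ℂ) i 0 y) f := by
  induction i using Fin.induction generalizing f with
  | zero => exact ⟨f, le_rfl, SupportLE.refl f, fun y => by rw [Fin.insertNth_zero']⟩
  | succ k ih =>
    obtain ⟨g', h1', h2', h3'⟩ := exists_demazureLusztig h k f
    obtain ⟨g, h1, h2, h3⟩ := ih g'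
    refine ⟨g, h1.trans h1', h2'.trans h2, fun y => ?_⟩
    rw [h3, h3' _ (by simp), insertNth_castSucc_comp_adj]

lemma supportLE_rotate (hq : q ≠ 0) (f : MvPolynomial (Fin (n + 1)) ℂ) :
    SupportLE q t 1 f ((X (Fin.last n) - C 1) * rotate q f) := by
  intro w hw
  rcases eq_addZero_or_eq_phi w with ⟨v, rfl⟩ | ⟨v, rfl⟩
  · simp [spec_addZero_last] at hw
  · rw [map_mul, eval_spec_phi_rotate hq] at hw
    exact ⟨v, by simp, sub_phi v, right_ne_zero_of_mul hw⟩

/-- The operators of which the interpolation polynomials are the eigenfunctions. -/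
lemma exists_eigenoperator (h : Generic (n + 1) q t) (i : Fin (n + 1))
    (f : MvPolynomial (Fin (n + 1)) ℂ) : ∃ G K : MvPolynomial (Fin (n + 1)) ℂ,
      X i * G = f + K ∧ G.totalDegree ≤ f.totalDegree ∧ SupportLE q t 1 f K := by
  obtain ⟨g, hg1, hg2, hg3⟩ := exists_moveFirst h i f
  obtain ⟨K, hK1, hK2, hK3⟩ := exists_moveLast h i ((X (Fin.last n) - C 1) * rotate q g)
  have hdvd : X i ∣ f + K := by
    -- On `xᵢ = 0` the factor `xₙ - 1` becomes `-1`, and moving the zero to the front, rotating it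
    -- to the end and moving it back to `i` restores the point; hence `K = -f` there.
    have hd : (X i : MvPolynomial (Fin (n + 1)) ℂ) ∣
        aeval X (f + K) - aeval (Function.update X i 0) (f + K) := by
      refine dvd_aeval_sub_aeval (fun j => ?_) (f + K)
      rcases eq_or_ne j i with rfl | hj
      · simp
      · simp [hj]
    have h0 : aeval (Function.update X i 0) (f + K) = (0 : MvPolynomial (Fin (n + 1)) ℂ) := by
      refine MvPolynomial.funext fun x => ?_
      have : (aeval x).comp (aeval (Function.update X i (0 : MvPolynomial (Fin (n + 1)) ℂ))) =
          aeval (Fin.insertNth (α := fun _ => ℂ) i 0 (fun j => x (i.succAbove j))) :=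
        algHom_ext fun j => by
          refine Fin.succAboveCases i ?_ (fun j => ?_) j <;> simp
      have h1 := DFunLike.congr_fun this (f + K)
      simp only [AlgHom.comp_apply, aeval_eq_eval] at h1
      rw [h1, map_add, hK3, map_mul, eval_rotate]
      simp [hg3]
    rw [h0, sub_zero, aeval_X_left_apply] at hd
    exact hd
  obtain ⟨G, hG⟩ := hdvd
  refine ⟨G, K, hG.symm, ?_, ?_⟩
  · rcases eq_or_ne G 0 with rfl | h0
    · simp
    · have h1 : (f + K).totalDegree ≤ f.totalDegree + 1 := by
        refine (totalDegree_add _ _).trans (max_le (Nat.le_succ _) (hK1.trans ?_))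
        refine (totalDegree_mul _ _).trans ?_
        rw [totalDegree_X_sub_of_lt (totalDegree_C 1), add_comm]
        exact Nat.add_le_add_right ((totalDegree_rotate_le g).trans hg1) 1
      rw [hG, totalDegree_mul_of_isDomain (X_ne_zero i) h0, totalDegree_X] at h1
      omega
  · exact (hg2.trans (supportLE_rotate h.1 g)).trans hK2

/-- Extra vanishing of the interpolation polynomials. -/
lemma IsDual.sub_of_eval_ne_zero (h : Generic n q t) {u : Fin n → ℕ} {E : MvPolynomial (Fin n) ℂ}
    (hE : IsDual q t u E) (w : Fin n → ℕ) (hw : eval (spec q t w) E ≠ 0) : Sub u w := by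
  rcases n with _ | n
  · rw [Subsingleton.elim u w]; exact Sub.refl w
  induction hs : size w using Nat.strong_induction_on generalizing w with
  | _ s ih =>
  rcases eq_or_ne u w with rfl | hne
  · exact Sub.refl u
  obtain ⟨i, hi⟩ := Function.ne_iff.mp (h.spec_injective.ne hne)
  obtain ⟨G, K, h1, h2, h3⟩ := exists_eigenoperator h i E
  have hev : ∀ x, x i * eval x G = eval x E + eval x K := fun x => by
    simpa using congrArg (eval x) h1
  -- For `|v| ≤ |u|` the polynomial `K` vanishes at `⟨v⟩`, since it only sees `E` at sizes below
  -- `|u|`. Thus `E` is an eigenfunction by unisolvence.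
  have hG : G = C (spec q t u i)⁻¹ * E := by
    refine eq_of_eval_spec_eq h (h2.trans hE.1) ((totalDegree_mul _ _).trans
      (by simpa using hE.1)) fun v hv => ?_
    have hK : eval (spec q t v) K = 0 := by
      by_contra h0
      obtain ⟨w', hw1, -, hw3⟩ := h3 v h0
      refine hw3 (hE.3 w' (by omega) ?_)
      rintro rfl
      omega
    have := hev (spec q t v)
    rw [hK, add_zero] at this
    rcases eq_or_ne v u with rfl | hvu
    · rw [map_mul, eval_C, ← this, inv_mul_cancel_left₀ (h.spec_ne_zero v i)]
    · rw [hE.3 v hv hvu] at this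
      simp [hE.3 v hv hvu, (mul_eq_zero.mp this).resolve_left (h.spec_ne_zero v i)]
  -- If `K` vanished at `⟨w⟩`, the eigenvalue equation would force `⟨w⟩ᵢ = ⟨u⟩ᵢ`.
  have hK : eval (spec q t w) K ≠ 0 := by
    intro h0
    have := hev (spec q t w)
    rw [h0, add_zero, hG, map_mul, eval_C, ← mul_assoc] at this
    have h4 := (mul_eq_right₀ hw).mp this
    rw [mul_inv_eq_one₀ (h.spec_ne_zero u i)] at h4
    exact hi h4.symm
  obtain ⟨w', hw1, hw2, hw3⟩ := h3 w hK
  exact (ih (size w') (by omega) w' hw3 rfl).trans hw2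

end Vanishing

end PolynomialPart

open PowerSeries

/-! ### Infinite products as formal power series -/

section InfiniteProducts

lemma multipliable_one_sub_C_mul_X {ι : Type*} {b : ι → ℂ} (hb : Summable fun i => ‖b i‖) :
    Multipliable fun i => (1 - C (b i) * X : PowerSeries ℂ) := by
  have hs : Summable fun s : Finset ι => ∏ i ∈ s, (C (-b i) * X : PowerSeries ℂ) := by
    rw [PowerSeries.WithPiTopology.summable_iff_summable_coeff]
    intro d
    refine (summable_finsetProd_of_summable_nonneg (fun i => norm_nonneg (b i)) hb).of_norm_bounded
      fun s => ?_
    rw [Finset.prod_mul_distrib, Finset.prod_const, ← map_prod, coeff_C_mul, coeff_X_pow]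
    split_ifs
    · simp [norm_prod]
    · simpa using Finset.prod_nonneg fun i _ => norm_nonneg (b i)
  simpa [sub_eq_add_neg] using multipliable_one_add_of_summable_prod hs

lemma summable_norm_mul_pow (hq : ‖q‖ < 1) (b : ℂ) : Summable fun j : ℕ => ‖b * q ^ j‖ := by
  simpa using (summable_geometric_of_lt_one (norm_nonneg q) hq).mul_left ‖b‖

lemma multipliable_qPochInf (hq : ‖q‖ < 1) (b : ℂ) :
    Multipliable fun j : ℕ => (1 - C (b * q ^ j) * X : PowerSeries ℂ) :=
  multipliable_one_sub_C_mul_X (summable_norm_mul_pow hq b)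

lemma constantCoeff_qPochInf (hq : ‖q‖ < 1) (b : ℂ) : constantCoeff (qPochInf q b) = 1 := by
  rw [qPochInf, (multipliable_qPochInf hq b).map_tprod constantCoeff
    (PowerSeries.WithPiTopology.continuous_constantCoeff ℂ)]
  simp

lemma qPochInf_eq_mul (hq : ‖q‖ < 1) (b : ℂ) :
    qPochInf q b = (1 - C b * X) * qPochInf q (b * q) := by
  have hj : ∀ j : ℕ, b * q * q ^ j = b * q ^ (j + 1) := fun j => by ring
  have h := multipliable_qPochInf hq (b * q)
  simp only [hj] at h
  have h2 := tprod_eq_zero_mul' (f := fun j : ℕ => (1 - C (b * q ^ j) * X : PowerSeries ℂ)) h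
  simp only [pow_zero, mul_one] at h2
  simp only [qPochInf, hj]
  exact h2

lemma qPochInf_eq_prod_mul (hq : ‖q‖ < 1) (b : ℂ) (m : ℕ) :
    qPochInf q b = (∏ j ∈ Finset.range m, (1 - C (b * q ^ j) * X)) * qPochInf q (b * q ^ m) := by
  induction m with
  | zero => simp
  | succ m ih =>
    rw [ih, Finset.prod_range_succ, qPochInf_eq_mul hq (b * q ^ m), pow_succ, ← mul_assoc b,
      mul_assoc _ _ (qPochInf _ _)]

lemma continuous_rescale (b : ℂ) : Continuous (rescale b) := by
  refine continuous_iff_continuousAt.mpr fun f => ?_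
  refine (PowerSeries.WithPiTopology.tendsto_iff_coeff_tendsto _ _ _ _).mpr fun d => ?_
  simp only [coeff_rescale]
  exact (continuous_const.mul (PowerSeries.WithPiTopology.continuous_coeff ℂ d)).tendsto f

lemma qPochInf_eq_rescale (hq : ‖q‖ < 1) (b : ℂ) : qPochInf q b = rescale b (qPochInf q 1) := by
  rw [qPochInf, qPochInf, (multipliable_qPochInf hq 1).map_tprod (rescale b) (continuous_rescale b)]
  refine tprod_congr fun j => ?_
  have : rescale b (C (q ^ j)) = C (q ^ j) := by
    ext d
    rw [coeff_rescale, coeff_C]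
    split_ifs with h <;> simp [h]
  rw [one_mul, map_sub (rescale b), map_mul (rescale b), rescale_X, this, map_one (rescale b),
    ← mul_assoc, ← map_mul, mul_comm b]

/-- The series depends on `a` and `b` only through `ab`. This makes the right-hand side polynomial
in `x`, coefficient by coefficient. -/
lemma coeff_inv_qPochInf (hq : ‖q‖ < 1) (b : ℂ) (r : ℕ) :
    coeff r (qPochInf q b)⁻¹ = coeff r (qPochInf q 1)⁻¹ * b ^ r := by
  have h : (qPochInf q b)⁻¹ = rescale b (qPochInf q 1)⁻¹ := by
    rw [eq_comm, PowerSeries.eq_inv_iff_mul_eq_one (by simp [constantCoeff_qPochInf hq]),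
      qPochInf_eq_rescale hq b, ← map_mul, PowerSeries.inv_mul_cancel _
      (by simp [constantCoeff_qPochInf hq]), map_one]
  rw [h, coeff_rescale, mul_comm]

lemma prod_inv_powerSeries {ι : Type*} (s : Finset ι) (f : ι → PowerSeries ℂ) :
    (∏ i ∈ s, f i)⁻¹ = ∏ i ∈ s, (f i)⁻¹ := by
  classical
  induction s using Finset.induction_on with
  | empty => simp
  | insert a s ha ih => rw [Finset.prod_insert ha, Finset.prod_insert ha, PowerSeries.mul_inv_rev, ih,
      mul_comm]

lemma tprod_divOneSub (hq : ‖q‖ < 1) (A : Fin n → ℂ) :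
    ∏' p : Fin n × ℕ, (1 - C (divOneSub q A p) * X : PowerSeries ℂ) = ∏ i, qPochInf q (A i) := by
  have hs : Summable fun p : Fin n × ℕ => ‖divOneSub q A p‖ := by
    rw [summable_prod_of_nonneg fun _ => norm_nonneg _]
    exact ⟨fun i => summable_norm_mul_pow hq (A i), Summable.of_finite⟩
  have hm := multipliable_one_sub_C_mul_X hs
  rw [hm.tprod_prod' fun i => multipliable_qPochInf hq (A i), tprod_fintype]
  rfl

lemma sigmaSub_divOneSub (hq : ‖q‖ < 1) (A B : Fin n → ℂ) :
    sigmaSub (divOneSub q A) (divOneSub q B) =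
      ∏ i, (qPochInf q (B i) * (qPochInf q (A i))⁻¹) := by
  rw [sigmaSub, tprod_divOneSub hq, tprod_divOneSub hq, prod_inv_powerSeries,
    Finset.prod_mul_distrib]

/-- The coefficients of a product of linear factors `1 - bX`, from its degree on. -/
lemma coeff_prod_one_sub_C_mul_X {ι : Type*} (s : Finset ι) (b : ι → ℂ) {r : ℕ}
    (hr : s.card ≤ r) : coeff r (∏ i ∈ s, (1 - C (b i) * X : PowerSeries ℂ)) =
      if r = s.card then ∏ i ∈ s, (-b i) else 0 := by
  classical
  induction s using Finset.induction_on generalizing r with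
  | empty =>
    simp only [Finset.prod_empty, Finset.card_empty, coeff_one]
    by_cases h : r = 0 <;> simp [h]
  | insert a s ha ih =>
    rw [Finset.card_insert_of_notMem ha] at hr ⊢
    obtain ⟨r, rfl⟩ : ∃ k, r = k + 1 := ⟨r - 1, by omega⟩
    rw [Finset.prod_insert ha, Finset.prod_insert ha, sub_mul, one_mul, mul_assoc, map_sub,
      coeff_C_mul, coeff_succ_X_mul, ih (by omega), ih (by omega), if_neg (by omega)]
    by_cases h : r = s.card <;> simp [h]

end InfiniteProducts

/-! ### Comparison of coefficients at spectral vectors -/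

section BinomialTheorem

/-- The coefficient of `a ^ r` is a polynomial of degree at most `r` in `x`. -/
def IsGraded (F : (Fin n → ℂ) → PowerSeries ℂ) : Prop :=
  ∀ r, ∃ G : MvPolynomial (Fin n) ℂ, G.totalDegree ≤ r ∧
    ∀ x, MvPolynomial.eval x G = coeff r (F x)

lemma isGraded_const (f : PowerSeries ℂ) : IsGraded fun _ : Fin n → ℂ => f :=
  fun r => ⟨MvPolynomial.C (coeff r f), by simp, fun x => by simp⟩

lemma isGraded_inv_qPochInf (hq : ‖q‖ < 1) (i : Fin n) :
    IsGraded fun x : Fin n → ℂ => (qPochInf q (x i))⁻¹ := by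
  refine fun r => ⟨MvPolynomial.C (coeff r (qPochInf q 1)⁻¹) * MvPolynomial.X i ^ r, ?_, fun x => ?_⟩
  · exact (MvPolynomial.totalDegree_mul _ _).trans (by simp)
  · rw [coeff_inv_qPochInf hq (x i)]; simp

lemma IsGraded.mul {F G : (Fin n → ℂ) → PowerSeries ℂ} (hF : IsGraded F) (hG : IsGraded G) :
    IsGraded fun x => F x * G x := by
  choose P hP hP' using hF
  choose Q hQ hQ' using hG
  refine fun r => ⟨∑ p ∈ Finset.HasAntidiagonal.antidiagonal r, P p.1 * Q p.2, ?_, fun x => ?_⟩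
  · refine MvPolynomial.totalDegree_finsetSum_le fun p hp => ?_
    rw [← Finset.HasAntidiagonal.mem_antidiagonal.mp hp]
    exact (MvPolynomial.totalDegree_mul _ _).trans (add_le_add (hP _) (hQ _))
  · simp [coeff_mul, hP', hQ']

lemma IsGraded.prod {ι : Type*} (s : Finset ι) {F : ι → (Fin n → ℂ) → PowerSeries ℂ}
    (hF : ∀ i, IsGraded (F i)) : IsGraded fun x => ∏ i ∈ s, F i x := by
  classical
  induction s using Finset.induction_on with
  | empty => simpa using isGraded_const 1
  | insert a s ha ih =>
    simp only [Finset.prod_insert ha]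
    exact (hF a).mul ih

lemma exists_eq_pow_mul_of_sub {v w : Fin n → ℕ} (h : Sub v w) :
    ∃ (σ : Equiv.Perm (Fin n)) (m : Fin n → ℕ), (∀ i, w (σ i) = v i + m i) ∧
      ∀ i, tExp w (σ i) = tExp v i := by
  obtain ⟨σ, hσ⟩ := h
  exact ⟨σ, fun i => w (σ i) - v i, fun i => (Nat.add_sub_of_le (hσ i).1).symm, fun i => (hσ i).2.symm⟩

/-- If `v` is contained in `w` then `∏ (a⟨v⟩ᵢ)_∞ / (a⟨w⟩ᵢ)_∞` is a polynomial in `a` of degree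
`|w| - |v|` with leading coefficient `𝖬_w(⟨w⟩) / 𝖬_v(⟨v⟩)`. -/
lemma coeff_prod_qPochInf_spec (hq : ‖q‖ < 1) {v w : Fin n → ℕ} (h : Sub v w) {r : ℕ}
    (hr : size w ≤ size v + r) :
    tau q t v * coeff r (∏ i, (qPochInf q (spec q t v i) * (qPochInf q (spec q t w i))⁻¹)) =
      if size w = size v + r then tau q t w else 0 := by
  obtain ⟨σ, m, hw, ht⟩ := exists_eq_pow_mul_of_sub h
  have hspec : ∀ i, spec q t w (σ i) = spec q t v i * q ^ m i := fun i => by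
    rw [spec, spec, hw, ht, pow_add]; ring
  -- After matching positions of equal rank, `⟨w⟩_{σ(i)} = ⟨v⟩ᵢ q^{mᵢ}`, so each quotient is a
  -- finite product of `mᵢ` factors.
  have hprod : ∏ i, (qPochInf q (spec q t v i) * (qPochInf q (spec q t w i))⁻¹) =
      ∏ p ∈ Finset.univ.sigma fun i => Finset.range (m i),
        (1 - C (spec q t v p.1 * q ^ p.2) * X) := by
    rw [Finset.prod_sigma, Finset.prod_mul_distrib,
      ← Equiv.prod_comp σ fun i => (qPochInf q (spec q t w i))⁻¹, ← Finset.prod_mul_distrib]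
    refine Finset.prod_congr rfl fun i _ => ?_
    rw [hspec, qPochInf_eq_prod_mul hq _ (m i), mul_assoc, PowerSeries.mul_inv_cancel _
      (by simp [constantCoeff_qPochInf hq]), mul_one]
  have hsize : size w = size v + ∑ i, m i := by
    rw [← size_comp_perm w σ, size, size, ← Finset.sum_add_distrib]
    exact Finset.sum_congr rfl fun i _ => hw i
  have hcard : (Finset.univ.sigma fun i => Finset.range (m i)).card = ∑ i, m i := by
    simp
  have htau : tau q t w = tau q t v *
      ∏ p ∈ Finset.univ.sigma fun i => Finset.range (m i), (-(spec q t v p.1 * q ^ p.2)) := by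
    rw [Finset.prod_sigma, tau, tau, ← Finset.prod_mul_distrib, ← Equiv.prod_comp σ]
    refine Finset.prod_congr rfl fun i _ => ?_
    rw [hw, ht, Finset.prod_range_add]
    congr 1
    exact Finset.prod_congr rfl fun j _ => by rw [spec, pow_add]; ring
  rw [hprod, coeff_prod_one_sub_C_mul_X _ _ (by omega), hcard, htau]
  by_cases hs : r = ∑ i, m i
  · rw [if_pos hs, if_pos (by omega)]
  · rw [if_neg hs, if_neg (by omega), mul_zero]

lemma mem_piAntidiag_univ {m : ℕ} {u : Fin n → ℕ} :
    u ∈ Finset.piAntidiag Finset.univ m ↔ size u = m := by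
  simp [size]

lemma Generic.sum_qbinom_mul_normM (h : Generic n q t) (v : Fin n → ℕ) (x : Fin n → ℂ) (m : ℕ) :
    ∑ u ∈ Finset.piAntidiag Finset.univ m, qbinom q t u v * normM q t u x =
      coeff m (C (normM q t v x) * X ^ size v *
        ∏ i, (qPochInf q (spec q t v i) * (qPochInf q (x i))⁻¹)) := by
  rw [mul_assoc, coeff_C_mul, coeff_X_pow_mul']
  split_ifs with hvm
  · obtain ⟨r, rfl⟩ := Nat.exists_eq_add_of_le hvm
    obtain ⟨G, hG, hGx⟩ := IsGraded.prod (n := n) Finset.univ (fun i =>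
      (isGraded_const (qPochInf q (spec q t v i))).mul (isGraded_inv_qPochInf h.2 i)) r
    -- The identity in `x`, divided by nothing: both sides have degree at most `|v| + r`, so testing
    -- at `⟨w⟩` with `|w| ≤ |v| + r` suffices.
    have key : ∑ u ∈ Finset.piAntidiag Finset.univ (size v + r),
        MvPolynomial.C (qbinom q t u v * tau q t u) * h.dual u =
          MvPolynomial.C (tau q t v) * (h.dual v * G) := by
      refine eq_of_eval_spec_eq h (d := size v + r) ?_ ?_ fun w hw => ?_
      · refine MvPolynomial.totalDegree_finsetSum_le fun u hu => ?_
        rw [← mem_piAntidiag_univ.mp hu]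
        refine (MvPolynomial.totalDegree_mul _ _).trans ?_
        rw [MvPolynomial.totalDegree_C, zero_add]
        exact (h.isDual_dual u).1
      · refine (MvPolynomial.totalDegree_mul _ _).trans ?_
        rw [MvPolynomial.totalDegree_C, zero_add]
        exact (MvPolynomial.totalDegree_mul _ _).trans (add_le_add (h.isDual_dual v).1 hG)
      · have hL : MvPolynomial.eval (spec q t w) (∑ u ∈ Finset.piAntidiag Finset.univ (size v + r),
            MvPolynomial.C (qbinom q t u v * tau q t u) * h.dual u) =
              MvPolynomial.eval (spec q t w) (h.dual v) *
                if size w = size v + r then tau q t w else 0 := by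
          have h0 : ∀ u ∈ Finset.piAntidiag Finset.univ (size v + r), u ≠ w →
              MvPolynomial.eval (spec q t w)
                (MvPolynomial.C (qbinom q t u v * tau q t u) * h.dual u) = 0 := by
            intro u hu hne
            have hu' := mem_piAntidiag_univ.mp hu
            rw [map_mul, (h.isDual_dual u).3 w (by omega) hne.symm, mul_zero]
          rw [map_sum]
          split_ifs with hs
          · rw [Finset.sum_eq_single_of_mem w (mem_piAntidiag_univ.mpr hs) h0, map_mul,
              MvPolynomial.eval_C, (h.isDual_dual w).2, mul_one, h.qbinom_eq]
          · rw [mul_zero]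
            refine Finset.sum_eq_zero fun u hu => h0 u hu ?_
            rintro rfl
            exact hs (mem_piAntidiag_univ.mp hu)
        rw [hL, map_mul, map_mul, MvPolynomial.eval_C, hGx]
        by_cases h0 : MvPolynomial.eval (spec q t w) (h.dual v) = 0
        · simp [h0]
        · rw [← coeff_prod_qPochInf_spec h.2 ((h.isDual_dual v).sub_of_eval_ne_zero h w h0) hw]
          ring
    have := congrArg (MvPolynomial.eval x) key
    simp only [map_sum, map_mul, MvPolynomial.eval_C, hGx] at this
    rw [Nat.add_sub_cancel_left, h.normM_eq, mul_assoc, ← this]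
    exact Finset.sum_congr rfl fun u _ => by rw [h.normM_eq, mul_assoc]
  · rw [mul_zero]
    refine Finset.sum_eq_zero fun u hu => ?_
    have hu' := mem_piAntidiag_univ.mp hu
    rw [h.qbinom_eq, (h.isDual_dual v).3 u (by omega) (by rintro rfl; omega), zero_mul]

/-- Convergence is coefficientwise, and only the finitely many `u` of size `m` contribute to the
coefficient of `a^m`. -/
lemma Generic.hasSum_qbinom_mul_normM (h : Generic n q t) (v : Fin n → ℕ) (x : Fin n → ℂ) :
    HasSum (fun u : Fin n → ℕ => C (qbinom q t u v * normM q t u x) * X ^ size u)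
      (C (normM q t v x) * X ^ size v *
        ∏ i, (qPochInf q (spec q t v i) * (qPochInf q (x i))⁻¹)) := by
  rw [PowerSeries.WithPiTopology.hasSum_iff_hasSum_coeff]
  intro m
  rw [← h.sum_qbinom_mul_normM v x m]
  simp only [coeff_C_mul, coeff_X_pow]
  have := hasSum_sum_of_ne_finset_zero (L := .unconditional _) (s := Finset.piAntidiag Finset.univ m)
    (f := fun u : Fin n → ℕ => qbinom q t u v * normM q t u x * if m = size u then 1 else 0)
    fun u hu => by
      rw [if_neg fun hm => hu (mem_piAntidiag_univ.mpr hm.symm), mul_zero]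
  rwa [Finset.sum_congr rfl fun u hu => by
    rw [if_pos (mem_piAntidiag_univ.mp hu).symm, mul_one]] at this

lemma spec_zero (i : Fin n) : spec q t 0 i = t ^ (n - 1 - (i : ℕ)) := by
  have : tExp (0 : Fin n → ℕ) i = n - 1 - i := by
    simp [tExp, Finset.filter_lt_eq_Ioi]
  simp [spec, this]

lemma Generic.normM_zero (h : Generic n q t) (x : Fin n → ℂ) : normM q t 0 x = 1 := by
  have h1 : IsDual q t (0 : Fin n → ℕ) 1 :=
    ⟨by simp, by simp, fun v hv hne => absurd (eq_zero_of_size_eq_zero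
      (Nat.le_zero.mp (hv.trans (by simp [size])))) hne⟩
  rw [h1.normM_eq h]
  simp [tau]

lemma Generic.qbinom_zero_right (h : Generic n q t) (u : Fin n → ℕ) : qbinom q t u 0 = 1 := by
  simp [qbinom, h.normM_zero]

end BinomialTheorem

end InterpolationMacdonald

end

theorem theorem7p1 (n : ℕ) (q t : ℂ) (hq0 : q ≠ 0) (hq1 : ‖q‖ < 1) (ht0 : t ≠ 0)
    (hqt : ∀ i j : ℕ, 1 ≤ i → 1 ≤ j → j < n → q ^ i * t ^ j ≠ 1) :
    -- the objects in the identity are well defined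
    (∀ u : Fin n → ℕ, ∃! P : MvPolynomial (Fin n) ℂ,
      InterpolationMacdonald.IsInterpolation q t u P) ∧
    (∀ u : Fin n → ℕ, InterpolationMacdonald.cPrime q t u ≠ 0 ∧
      InterpolationMacdonald.normM q t u (InterpolationMacdonald.spec q t u) ≠ 0) ∧
    -- the identity for general `v`, as formal power series in `a = PowerSeries.X`
    (∀ (v : Fin n → ℕ) (x : Fin n → ℂ),
      HasSum
        (fun u : Fin n → ℕ =>
          PowerSeries.C (InterpolationMacdonald.qbinom q t u v *
            InterpolationMacdonald.normM q t u x) *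
          PowerSeries.X ^ InterpolationMacdonald.size u)
        (PowerSeries.C (InterpolationMacdonald.normM q t v x) *
          PowerSeries.X ^ InterpolationMacdonald.size v *
          ∏ i, (InterpolationMacdonald.qPochInf q (InterpolationMacdonald.spec q t v i) *
            (InterpolationMacdonald.qPochInf q (x i))⁻¹)) ∧
      -- the second form of the right-hand side
      PowerSeries.C (InterpolationMacdonald.normM q t v x) *
          PowerSeries.X ^ InterpolationMacdonald.size v *
          ∏ i, (InterpolationMacdonald.qPochInf q (InterpolationMacdonald.spec q t v i) *
            (InterpolationMacdonald.qPochInf q (x i))⁻¹) =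
        PowerSeries.C (InterpolationMacdonald.normM q t v x) *
          PowerSeries.X ^ InterpolationMacdonald.size v *
          InterpolationMacdonald.sigmaSub (InterpolationMacdonald.divOneSub q x)
            (InterpolationMacdonald.divOneSub q (InterpolationMacdonald.spec q t v))) ∧
    -- the case `v = 0`; the index `i : Fin n` runs over `0, …, n - 1`
    (∀ x : Fin n → ℂ,
      HasSum
        (fun u : Fin n → ℕ =>
          PowerSeries.C (InterpolationMacdonald.normM q t u x) *
          PowerSeries.X ^ InterpolationMacdonald.size u)
        (∏ i : Fin n, (InterpolationMacdonald.qPochInf q (t ^ (n - 1 - (i : ℕ))) *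
            (InterpolationMacdonald.qPochInf q (x i))⁻¹))) := by
  have h : InterpolationMacdonald.Generic n q t := ⟨hq0, hq1, ht0, hqt⟩
  refine ⟨h.existsUnique_isInterpolation, fun u => ⟨h.cPrime_ne_zero u, ?_⟩,
    fun v x => ⟨h.hasSum_qbinom_mul_normM v x, ?_⟩, fun x => ?_⟩
  · rw [h.normM_spec_self]
    exact h.tau_ne_zero u
  · rw [InterpolationMacdonald.sigmaSub_divOneSub hq1]
  · simpa [h.qbinom_zero_right, h.normM_zero, InterpolationMacdonald.spec_zero,
      InterpolationMacdonald.size] using h.hasSum_qbinom_mul_normM 0 x
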